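/- Let $\lambda\in\mathbb R$ and $\eta\ge 0$. Let $(P_n)_{n\ge0}$ be the monic polynomials of the centered classical Meixner class given by $$xP_n(x)=P_{n+1}(x)+\lambda n P_n(x)+n(1+\eta(n-1))P_{n-1}(x),\qquad n\ge 0,\quad P_0=1,\ P_{-1}=0,$$ and let $(Q_n)_{n\ge0}$ be the monic polynomials given by $$xQ_n(x)=Q_{n+1}(x)+\lambda(n+1)Q_n(x)+\eta n(n+1)Q_{n-1}(x),\qquad n\ge 0,\quad Q_0=1,\ Q_{-1}=0.$$ Let $\mathcal E^1_{\min}(\mathbb R)$ be the space of restrictions to $\mathbb R$ of the entire functions $F$ such that for every $\varepsilon>0$ there is $K>0$ with $|F(z)|\le K e^{\varepsilon|z|}$ for all $z\in\mathbb C$, with the topology given by the norms $N_q(f)^{1/2}$, $q\in\mathbb N$, where $N_q(f)=\sum_{n\ge0}|f_n|^2(n!)^2 2^{nq}$ for $f(x)=\sum_{n\ge0} f_nx^n$. There is a probability measure $\nu_{\lambda,\eta}$ on $\mathbb R$, with all moments finite, which is a measure of orthogonality of $(Q_n)_{n\ge0}$, that is, $\int Q_mQ_n\,d\nu_{\lambda,\eta}=0$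 for $m\ne n$. There is a unique continuous linear operator $\partial_{\lambda,\eta}$ on $\mathcal E^1_{\min}(\mathbb R)$ with $\partial_{\lambda,\eta}P_n=nP_{n-1}$ for all $n\ge0$ (the lowering operator). For every such measure $\nu_{\lambda,\eta}$, every $f\in\mathcal E^1_{\min}(\mathbb R)$ and every $x\in\mathbb R$: if $(\lambda,\eta)\ne(0,0)$, then the integral below converges absolutely and $$(\partial_{\lambda,\eta}f)(x)=\int_{\mathbb R}\frac{f(x+s)-f(x)}{s}\,\nu_{\lambda,\eta}(ds);$$ if $\lambda=\eta=0$ (the Gaussian case, where $\nu_{0,0}=\delta_0$), the formula is understood in the limiting sense, $(\partial_{0,0}f)(x)=f'(x)$. -/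

import Mathlib

open MeasureTheory Polynomial
open scoped ENNReal NNReal

namespace Meixner

/-- The monic polynomials `P_n` of the centered Meixner class with parameters `lam`, `eta`
(and `t = 1`, `l = 0`):
`x P_n = P_{n+1} + lam n P_n + n (1 + eta (n - 1)) P_{n-1}`, `P_0 = 1`, `P_{-1} = 0`. -/
noncomputable def P (lam eta : ℝ) : ℕ → ℝ[X]
  | 0 => 1
  | 1 => X
  | n + 2 => (X - C (lam * (n + 1))) * P lam eta (n + 1)
      - C ((n + 1) * (1 + eta * n)) * P lam eta n

/-- The auxiliary monic polynomials `Q_n`: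
`x Q_n = Q_{n+1} + lam (n + 1) Q_n + eta n (n + 1) Q_{n-1}`, `Q_0 = 1`, `Q_{-1} = 0`. -/
noncomputable def Q (lam eta : ℝ) : ℕ → ℝ[X]
  | 0 => 1
  | 1 => X - C lam
  | n + 2 => (X - C (lam * (n + 2))) * Q lam eta (n + 1)
      - C (eta * (n + 1) * (n + 2)) * Q lam eta n

/-- `ν` is a (probability) measure of orthogonality of the polynomials `p 0, p 1, …`:
it has finite moments of all orders, and distinct members of the sequence are orthogonal
in `L²(ν)`. -/
structure IsOrthogonalityMeasure (p : ℕ → ℝ[X]) (ν : Measure ℝ) : Prop where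
  isProbabilityMeasure : IsProbabilityMeasure ν
  integrable_pow : ∀ n : ℕ, Integrable (fun s : ℝ => s ^ n) ν
  orthogonal : ∀ m n : ℕ, m ≠ n → ∫ s, (p m).eval s * (p n).eval s ∂ν = 0

/-- `F` is an entire function of first order of growth and minimal type. -/
def IsEntireMin (F : ℂ → ℂ) : Prop :=
  Differentiable ℂ F ∧
    ∀ ε : ℝ, 0 < ε → ∃ K : ℝ, 0 < K ∧ ∀ z : ℂ, ‖F z‖ ≤ K * Real.exp (ε * ‖z‖)

/-- The space of restrictions to `ℝ` of the entire functions of first order of growth and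
minimal type. -/
def EMin : Submodule ℂ (ℝ → ℂ) where
  carrier := {f | ∃ F : ℂ → ℂ, IsEntireMin F ∧ ∀ x : ℝ, f x = F x}
  zero_mem' := by
    refine ⟨fun _ => 0, ⟨differentiable_const _, fun ε _ => ⟨1, one_pos, fun z => ?_⟩⟩,
      fun x => rfl⟩
    rw [norm_zero]
    positivity
  add_mem' := by
    rintro f g ⟨F, ⟨hF, hF'⟩, hf⟩ ⟨G, ⟨hG, hG'⟩, hg⟩
    refine ⟨fun z => F z + G z, ⟨hF.add hG, fun ε hε => ?_⟩, fun x => ?_⟩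
    · obtain ⟨K, hK, h1⟩ := hF' ε hε
      obtain ⟨L, hL, h2⟩ := hG' ε hε
      refine ⟨K + L, by positivity, fun z => ?_⟩
      calc ‖F z + G z‖ ≤ ‖F z‖ + ‖G z‖ := norm_add_le _ _
        _ ≤ (K + L) * Real.exp (ε * ‖z‖) := by rw [add_mul]; exact add_le_add (h1 z) (h2 z)
    · simp [hf x, hg x]
  smul_mem' := by
    rintro c f ⟨F, ⟨hF, hF'⟩, hf⟩
    refine ⟨fun z => c * F z, ⟨hF.const_mul c, fun ε hε => ?_⟩, fun x => ?_⟩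
    · obtain ⟨K, hK, h1⟩ := hF' ε hε
      refine ⟨(‖c‖ + 1) * K, by positivity, fun z => ?_⟩
      rw [norm_mul, mul_assoc]
      exact mul_le_mul (by linarith) (h1 z) (norm_nonneg _) (by positivity)
    · simp [hf x]

theorem polynomial_mem_EMin (p : ℝ[X]) : (fun x : ℝ => ((p.eval x : ℝ) : ℂ)) ∈ EMin := by
  induction p using Polynomial.induction_on' with
  | add p q hp hq =>
    have h := EMin.add_mem hp hq
    convert h using 1
    ext x
    simp
  | monomial n a =>
    have hX : (fun x : ℝ => (x : ℂ) ^ n) ∈ EMin := by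
      refine ⟨fun z => z ^ n, ⟨differentiable_id.pow n, fun ε hε => ?_⟩, fun x => rfl⟩
      refine ⟨n.factorial / ε ^ n, by positivity, fun z => ?_⟩
      have h := Real.pow_div_factorial_le_exp (ε * ‖z‖) (by positivity) n
      rw [div_le_iff₀ (by positivity), mul_pow] at h
      rw [norm_pow, div_mul_eq_mul_div, le_div_iff₀ (by positivity)]
      linarith
    have h := EMin.smul_mem (a : ℂ) hX
    convert h using 1
    ext x
    simp

/-- A real polynomial, as an element of the space `EMin`. -/
def ofPolynomial (p : ℝ[X]) : EMin :=
  ⟨fun x : ℝ => ((p.eval x : ℝ) : ℂ), polynomial_mem_EMin p⟩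

/-- For `f(x) = ∑ f_n x^n`, the quantity `N_q(f) = ∑ |f_n|² (n!)² 2^(n q)`, as an extended
nonnegative real. The square roots of the `N_q`, `q ∈ ℕ`, are an increasing sequence of norms
that defines the topology of `EMin`. -/
noncomputable def N (q : ℕ) (f : EMin) : ℝ≥0∞ :=
  ∑' n : ℕ, ‖iteratedDeriv n (f : ℝ → ℂ) 0 / (n.factorial : ℂ)‖ₑ ^ 2
    * (n.factorial : ℝ≥0∞) ^ 2 * 2 ^ (n * q)

/-- `D` is the lowering operator on `EMin`: the linear operator with `D P_n = n P_{n-1}`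
that is continuous for the topology given by the norms `N_q`. -/
structure IsLoweringOperator (lam eta : ℝ) (D : EMin →ₗ[ℂ] EMin) : Prop where
  lower_zero : D (ofPolynomial (P lam eta 0)) = 0
  lower_succ : ∀ n : ℕ, D (ofPolynomial (P lam eta (n + 1)))
    = ((n : ℂ) + 1) • ofPolynomial (P lam eta n)
  continuous : ∀ q : ℕ, ∃ r : ℕ, ∃ K : ℝ≥0, ∀ f : EMin, N q (D f) ≤ K * N r f

end Meixner

namespace Meixner

/-! Put D = g(∂) = ∑ g_k ∂^k, where g(0) = 0 and g' = 1 + λg + ηg². Since [h(∂), x] = h'(∂) for a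
power series h, we have [D, x] = 1 + λD + ηD². This relation alone makes D lower every monic family
with x p_n = p_{n+1} + (λn + c) p_n + n(d + η(n-1)) p_{n-1}, whatever c and d (`lower_coeffs_eq`); P
and Q are two such families.

Some probability measure has moment generating function g', that is, ∫ s^k = (k+1)! g_{k+1}
(`exists_hasMoments`). Integration of polynomials against it is p ↦ (D(xp))(0). On Q_{n+1} the
commutation relation turns this into (x Q_n)(0) = 0, and the recurrence upgrades that to
orthogonality. Conversely, orthogonality fixes all moments, so the argument covers every admissible
ν without determinacy of the moment problem.

For entire F, (F(x+s) - F(x))/s = ∑ F^{(k+1)}(x) s^k/(k+1)!. Termwise integration gives ∑ g_{k+1}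
F^{(k+1)}(x) = (DF)(x) (`HasMoments.integral_difference_quotient`). The expansion fails only at s =
0, where the quotient is 0 by convention instead of F'(x); hence ν must not charge 0
(`IsOrthogonalityMeasure.measure_zero`).

Analytically, f is replaced by the sequence f^{(n)}(0), which decays faster than any geometric
progression, while |g_k| ≤ C^k. So all series converge and D is continuous; density of polynomials
gives uniqueness. -/

/-- `g` is the formal power series with `g 0 = 0` and `g' = 1 + lam g + eta g²`. -/
structure IsRiccatiSeries (lam eta : ℝ) (g : ℕ → ℝ) : Prop where
  zero : g 0 = 0
  succ : ∀ k : ℕ, ((k : ℝ) + 1) * g (k + 1)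
    = (if k = 0 then 1 else 0) + lam * g k
      + eta * ∑ i ∈ Finset.range (k + 1), g i * g (k - i)

/-- `ν` is a probability measure with moments `∫ s ^ k = (k + 1)! g (k + 1)`. -/
structure HasMoments (g : ℕ → ℝ) (ν : Measure ℝ) : Prop where
  isProbabilityMeasure : IsProbabilityMeasure ν
  integrable_pow : ∀ n : ℕ, Integrable (fun s : ℝ => s ^ n) ν
  integral_pow : ∀ n : ℕ, ∫ s, s ^ n ∂ν = ((n + 1).factorial : ℝ) * g (n + 1)

/-! ### Existence of a measure with moment generating function g' -/

open ProbabilityTheory in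
/-- If the square of the moment generating function of `X` is `G'`, where
`G' = 1 + lam G + eta G²`, the sum of two independent copies of `X` has the moments given by
the Taylor series of `G`. -/
theorem exists_hasMoments_of_mgf {lam eta : ℝ} {Ω : Type*} [MeasurableSpace Ω] {μ : Measure Ω}
    [IsProbabilityMeasure μ] {X : Ω → ℝ} (hX : Measurable X) {δ : ℝ} (hδ : 0 < δ) {m G : ℝ → ℝ}
    (hint : ∀ u, |u| < δ → Integrable (fun ω => Real.exp (u * X ω)) μ)
    (hm : ∀ u, |u| < δ → ∫ ω, Real.exp (u * X ω) ∂μ = m u)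
    (hG : ∀ u, |u| < δ → HasDerivAt G (m u ^ 2) u)
    (hGs : ∀ n : ℕ, ContDiffAt ℝ n G 0) (hG0 : G 0 = 0)
    (hode : ∀ u, |u| < δ → m u ^ 2 = 1 + lam * G u + eta * G u ^ 2) :
    ∃ (ν : Measure ℝ) (g : ℕ → ℝ), IsRiccatiSeries lam eta g ∧ HasMoments g ν := by
  set Y : Ω × Ω → ℝ := fun p => X p.1 + X p.2 with hY
  have hYm : Measurable Y := by fun_prop
  set ν : Measure ℝ := (μ.prod μ).map Y with hν
  have hprob : IsProbabilityMeasure ν := Measure.isProbabilityMeasure_map hYm.aemeasurable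
  have hball : ∀ᶠ u : ℝ in nhds 0, |u| < δ := by
    have := Metric.ball_mem_nhds (0 : ℝ) hδ
    filter_upwards [this] with u hu
    simpa using hu
  have hexp : ∀ u, (fun p : Ω × Ω => Real.exp (u * Y p))
      = fun p => Real.exp (u * X p.1) * Real.exp (u * X p.2) := by
    intro u
    ext p
    rw [← Real.exp_add, hY]
    ring_nf
  have hintY : ∀ u, |u| < δ → Integrable (fun s => Real.exp (u * s)) ν := by
    intro u hu
    rw [hν, integrable_map_measure (by fun_prop) hYm.aemeasurable]
    change Integrable (fun p => Real.exp (u * Y p)) _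
    rw [hexp]
    exact (hint u hu).mul_prod (hint u hu)
  have hmgf : ∀ u, |u| < δ → mgf id ν u = m u ^ 2 := by
    intro u hu
    rw [mgf, hν, integral_map hYm.aemeasurable (by fun_prop)]
    change ∫ p, Real.exp (u * Y p) ∂_ = _
    rw [hexp, integral_prod_mul (fun x => Real.exp (u * X x)) (fun x => Real.exp (u * X x)),
      hm u hu, sq]
  have h0 : (0 : ℝ) ∈ interior (integrableExpSet id ν) := by
    rw [mem_interior_iff_mem_nhds]
    filter_upwards [hball] with u hu
    exact hintY u hu
  have hderiv : deriv G =ᶠ[nhds 0] mgf id ν := by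
    filter_upwards [hball] with u hu
    rw [(hG u hu).deriv, hmgf u hu]
  have hmom : ∀ n, iteratedDeriv (n + 1) G 0 = ∫ s, s ^ n ∂ν := by
    intro n
    rw [iteratedDeriv_succ', hderiv.iteratedDeriv_eq n, iteratedDeriv_mgf_zero h0]
    rfl
  -- The ODE differentiated n times at 0 by Leibniz; division by factorials makes the binomial sum a
  -- convolution.
  have hrec : ∀ n, iteratedDeriv (n + 1) G 0 = (if n = 0 then 1 else 0)
      + lam * iteratedDeriv n G 0 + eta * ∑ i ∈ Finset.range (n + 1),
        (n.choose i : ℝ) * iteratedDeriv i G 0 * iteratedDeriv (n - i) G 0 := by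
    intro n
    have h1 : deriv G =ᶠ[nhds 0] fun u => (1 + lam * G u) + eta * (G * G) u := by
      filter_upwards [hball] with u hu
      rw [(hG u hu).deriv, hode u hu, Pi.mul_apply, sq]
    rw [iteratedDeriv_succ', h1.iteratedDeriv_eq n,
      iteratedDeriv_fun_add (f := fun u => 1 + lam * G u) (g := fun u => eta * (G * G) u)
        (contDiffAt_const.add (contDiffAt_const.mul (hGs n)))
        (contDiffAt_const.mul ((hGs n).mul (hGs n))),
      iteratedDeriv_fun_add contDiffAt_const (contDiffAt_const.mul (hGs n)),
      iteratedDeriv_const_mul_field, iteratedDeriv_const_mul_field,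
      iteratedDeriv_mul (hGs n) (hGs n), iteratedDeriv_const]
  refine ⟨ν, fun k => iteratedDeriv k G 0 / k.factorial, ⟨by simp [hG0], fun k => ?_⟩,
    ⟨hprob, fun n => ?_, fun n => ?_⟩⟩
  · have hk : (k.factorial : ℝ) ≠ 0 := by positivity
    have hk1 : (k : ℝ) + 1 ≠ 0 := by positivity
    rw [Nat.factorial_succ, hrec k]
    push_cast
    rw [← mul_div_assoc, mul_div_mul_left _ _ hk1, add_div, add_div,
      mul_div_assoc, mul_div_assoc, Finset.sum_div]
    congr 2
    · split_ifs with h <;> simp [h]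
    · refine Finset.sum_congr rfl fun i hi => ?_
      rw [Nat.cast_choose ℝ (Nat.lt_succ_iff.mp (Finset.mem_range.mp hi))]
      field_simp
  · have := integrable_pow_of_mem_interior_integrableExpSet h0 n
    simpa using this
  · rw [← hmom n]
    field_simp

/-- Version for laws with a density w, whose total mass is `m 0 = 1`. -/
theorem exists_hasMoments_of_density {lam eta : ℝ} {Ω : Type*} [MeasurableSpace Ω]
    {μ : Measure Ω} {w X : Ω → ℝ} (hw : Measurable w) (hw0 : ∀ ω, 0 ≤ w ω)
    (hX : Measurable X) {δ : ℝ} (hδ : 0 < δ) {m G : ℝ → ℝ} (hm0 : m 0 = 1)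
    (hint : ∀ u, |u| < δ → Integrable (fun ω => Real.exp (u * X ω) * w ω) μ)
    (hm : ∀ u, |u| < δ → ∫ ω, Real.exp (u * X ω) * w ω ∂μ = m u)
    (hG : ∀ u, |u| < δ → HasDerivAt G (m u ^ 2) u)
    (hGs : ∀ n : ℕ, ContDiffAt ℝ n G 0) (hG0 : G 0 = 0)
    (hode : ∀ u, |u| < δ → m u ^ 2 = 1 + lam * G u + eta * G u ^ 2) :
    ∃ (ν : Measure ℝ) (g : ℕ → ℝ), IsRiccatiSeries lam eta g ∧ HasMoments g ν := by
  have hwm : Measurable fun ω => ENNReal.ofReal (w ω) := hw.ennreal_ofReal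
  have htop : ∀ᵐ ω ∂μ, ENNReal.ofReal (w ω) < ⊤ := by simp
  have h0 : |(0 : ℝ)| < δ := by simpa
  have hprob : IsProbabilityMeasure (μ.withDensity fun ω => ENNReal.ofReal (w ω)) := by
    have h1 := hint 0 h0
    have h2 := hm 0 h0
    simp only [zero_mul, Real.exp_zero, one_mul, hm0] at h1 h2
    constructor
    rw [withDensity_apply _ MeasurableSet.univ, Measure.restrict_univ,
      ← ofReal_integral_eq_lintegral_ofReal h1 (Filter.Eventually.of_forall hw0), h2,
      ENNReal.ofReal_one]
  refine exists_hasMoments_of_mgf (μ := μ.withDensity fun ω => ENNReal.ofReal (w ω)) hX hδ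
    (fun u hu => ?_) (fun u hu => ?_) hG hGs hG0 hode
  · rw [integrable_withDensity_iff hwm htop]
    simpa only [ENNReal.toReal_ofReal (hw0 _)] using hint u hu
  · rw [integral_withDensity_eq_integral_toReal_smul hwm htop, ← hm u hu]
    simp only [ENNReal.toReal_ofReal (hw0 _), smul_eq_mul, mul_comm]

theorem integrable_of_lintegral_ofReal_eq_one {Ω : Type*} [MeasurableSpace Ω] {μ : Measure Ω}
    {w : Ω → ℝ} (hw : Measurable w) (hw0 : ∀ ω, 0 ≤ w ω)
    (h : ∫⁻ ω, ENNReal.ofReal (w ω) ∂μ = 1) : Integrable w μ ∧ ∫ ω, w ω ∂μ = 1 := by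
  have h0 : 0 ≤ᵐ[μ] w := Filter.Eventually.of_forall hw0
  refine ⟨(lintegral_ofReal_ne_top_iff_integrable hw.aestronglyMeasurable h0).1 (by simp [h]), ?_⟩
  rw [integral_eq_lintegral_of_nonneg_ae h0 hw.aestronglyMeasurable, h, ENNReal.toReal_one]

open ProbabilityTheory in
/-- The case of a double root: the gamma distribution. -/
theorem exists_hasMoments_of_discrim_eq_zero {lam eta : ℝ} (h : lam ^ 2 = 4 * eta) :
    ∃ (ν : Measure ℝ) (g : ℕ → ℝ), IsRiccatiSeries lam eta g ∧ HasMoments g ν := by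
  obtain ⟨b, rfl⟩ : ∃ b, lam = 2 * b := ⟨lam / 2, by ring⟩
  obtain rfl : eta = b ^ 2 := by linarith
  have hpos : ∀ u, |u| < 1 / (|b| + 1) → 0 < 1 - b * u := by
    intro u hu
    have h1 : |b * u| ≤ (|b| + 1) * |u| := by
      rw [abs_mul]
      gcongr
      linarith
    rw [lt_div_iff₀' (by positivity)] at hu
    linarith [le_abs_self (b * u)]
  have hnn : ∀ {r : ℝ}, 0 < r → ∀ x, 0 ≤ exponentialPDFReal r x := exponentialPDFReal_nonneg
  -- Exponential tilting stays within the exponential laws: rate 1 becomes rate 1 - bu. The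
  -- transform is then the ratio of normalizing constants, and no integral has to be computed. The +
  -- 1 in the radius allows b = 0, the point mass at 0.
  have key : ∀ u, |u| < 1 / (|b| + 1) → ∀ x, Real.exp (u * (b * x)) * exponentialPDFReal 1 x
      = (1 - b * u)⁻¹ * exponentialPDFReal (1 - b * u) x := by
    intro u hu x
    have := hpos u hu
    simp only [exponentialPDFReal, gammaPDFReal, sub_self, Real.rpow_zero, Real.rpow_one,
      Real.Gamma_one, div_one, mul_one, one_mul]
    split_ifs
    · rw [inv_mul_cancel_left₀ this.ne', ← Real.exp_add]
      ring_nf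
    · simp
  have hI : ∀ u, |u| < 1 / (|b| + 1) → _ := fun u hu =>
    integrable_of_lintegral_ofReal_eq_one (measurable_exponentialPDFReal (1 - b * u))
      (hnn (hpos u hu)) (lintegral_exponentialPDF_eq_one (hpos u hu))
  refine exists_hasMoments_of_density (μ := volume) (w := exponentialPDFReal 1)
    (X := fun x => b * x) (m := fun u => (1 - b * u)⁻¹) (G := fun u => u / (1 - b * u))
    (measurable_exponentialPDFReal 1) (hnn one_pos) (by fun_prop)
    (δ := 1 / (|b| + 1)) (by positivity) (by simp) (fun u hu => ?_) (fun u hu => ?_)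
    (fun u hu => ?_) (fun n => ?_) (by simp) (fun u hu => ?_)
  · simp only [key u hu]
    exact (hI u hu).1.const_mul _
  · simp only [key u hu]
    rw [integral_const_mul, (hI u hu).2, mul_one]
  · have := (hpos u hu).ne'
    have h1 : HasDerivAt (fun u => 1 - b * u) (-b) u := by
      simpa using ((hasDerivAt_id u).const_mul b).const_sub 1
    refine ((hasDerivAt_id' u).div h1 this).congr_deriv ?_
    field_simp
    ring
  · exact contDiffAt_id.div (by fun_prop) (by simp)
  · have := (hpos u hu).ne'
    field_simp
    ring

open ProbabilityTheory in
/-- The case of complex roots. -/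
theorem exists_hasMoments_of_discrim_neg {lam eta : ℝ} (h : lam ^ 2 < 4 * eta) :
    ∃ (ν : Measure ℝ) (g : ℕ → ℝ), IsRiccatiSeries lam eta g ∧ HasMoments g ν := by
  set r : ℝ := Real.sqrt (eta - lam ^ 2 / 4) with hr
  have hr0 : 0 < r := Real.sqrt_pos.2 (by linarith)
  have hr2 : r ^ 2 = eta - lam ^ 2 / 4 := Real.sq_sqrt (by linarith)
  have hpi := Real.pi_pos
  -- The target is m(u) = cos θ / cos(θ + ru). The logarithmic derivative of m² at 0 is 2r tan θ and
  -- has to equal g''(0) = λ, which dictates θ.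
  set θ : ℝ := Real.arctan (lam / (2 * r)) with hθ
  have hθ1 : θ < Real.pi / 2 := Real.arctan_lt_pi_div_two _
  have hθ2 : -(Real.pi / 2) < θ := Real.neg_pi_div_two_lt_arctan _
  have hcos : 0 < Real.cos θ := Real.cos_arctan_pos _
  have hsin : Real.sin θ = lam / (2 * r) * Real.cos θ := by
    rw [← Real.tan_arctan (lam / (2 * r)), ← hθ, Real.tan_mul_cos hcos.ne']
  -- The law is that of b log(x/(1-x)) under Beta(a, 1-a). Tilting gives Beta(a + bu, 1 - a - bu),
  -- and the reflection formula evaluates its constant as π / cos(θ + ru).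
  set a : ℝ := 1 / 2 + θ / Real.pi with ha
  set b : ℝ := r / Real.pi with hb
  have hangle : ∀ u, Real.pi * (a + b * u) = (θ + r * u) + Real.pi / 2 := by
    intro u
    rw [ha, hb]
    field_simp
    ring
  -- For |u| < δ the angle θ + ru stays in (-π/2, π/2); equivalently, both beta parameters stay
  -- positive.
  set δ : ℝ := (Real.pi / 2 - |θ|) / r with hδ
  have hθ3 : |θ| < Real.pi / 2 := abs_lt.2 ⟨hθ2, hθ1⟩
  have hδ0 : 0 < δ := div_pos (by linarith) hr0
  have hstrip : ∀ u, |u| < δ → |θ + r * u| < Real.pi / 2 := by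
    intro u hu
    rw [hδ, lt_div_iff₀' hr0] at hu
    have := abs_add_le θ (r * u)
    rw [abs_mul, abs_of_pos hr0] at this
    linarith
  have hc : ∀ u, |u| < δ → 0 < Real.cos (θ + r * u) := fun u hu =>
    Real.cos_pos_of_mem_Ioo (abs_lt.1 (hstrip u hu))
  have hs : ∀ u, |u| < δ → 0 < a + b * u ∧ a + b * u < 1 := by
    intro u hu
    have h1 := abs_lt.1 (hstrip u hu)
    have h2 := hangle u
    constructor
    · refine pos_of_mul_pos_right (a := Real.pi) ?_ hpi.le
      linarith [h1.1]
    · refine lt_of_mul_lt_mul_left (a := Real.pi) ?_ hpi.le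
      linarith [h1.2]
  have ha01 : 0 < a ∧ a < 1 := by simpa using hs 0 (by simpa)
  have hbeta : ∀ u, |u| < δ → beta (a + b * u) (1 - (a + b * u))
      = Real.pi / Real.cos (θ + r * u) := by
    intro u hu
    rw [beta, Real.Gamma_mul_Gamma_one_sub, add_sub_cancel, Real.Gamma_one, div_one, hangle,
      Real.sin_add_pi_div_two]
  have hbeta0 : beta a (1 - a) = Real.pi / Real.cos θ := by simpa using hbeta 0 (by simpa)
  have hnn : ∀ {a : ℝ}, 0 < a → a < 1 → ∀ x, 0 ≤ betaPDFReal a (1 - a) x := by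
    intro a h0 h1 x
    by_cases hx : 0 < x ∧ x < 1
    · exact (betaPDFReal_pos hx.1 hx.2 h0 (by linarith)).le
    · rw [betaPDFReal, if_neg hx]
  have hI : ∀ u, |u| < δ → _ := fun u hu =>
    integrable_of_lintegral_ofReal_eq_one
      (measurable_betaPDFReal (a + b * u) (1 - (a + b * u)))
      (hnn (hs u hu).1 (hs u hu).2)
      (lintegral_betaPDF_eq_one (hs u hu).1 (sub_pos.2 (hs u hu).2))
  have key : ∀ u, |u| < δ → ∀ x,
      Real.exp (u * (b * (Real.log x - Real.log (1 - x)))) * betaPDFReal a (1 - a) x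
      = Real.cos θ / Real.cos (θ + r * u) * betaPDFReal (a + b * u) (1 - (a + b * u)) x := by
    intro u hu x
    have := (hc u hu).ne'
    rw [betaPDFReal, betaPDFReal, hbeta u hu, hbeta0]
    split_ifs with hx
    · have hx1 : 0 < 1 - x := by linarith [hx.2]
      have he : Real.exp (u * (b * (Real.log x - Real.log (1 - x)))) * x ^ (a - 1)
          * (1 - x) ^ (1 - a - 1)
          = x ^ (a + b * u - 1) * (1 - x) ^ (1 - (a + b * u) - 1) := by
        simp only [Real.rpow_def_of_pos hx.1, Real.rpow_def_of_pos hx1, ← Real.exp_add]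
        ring_nf
      calc _ = Real.cos θ / Real.pi *
            (Real.exp (u * (b * (Real.log x - Real.log (1 - x)))) * x ^ (a - 1)
              * (1 - x) ^ (1 - a - 1)) := by rw [one_div_div]; ring
        _ = _ := by
          rw [he, one_div_div]
          generalize Real.cos (θ + r * u) = C at *
          field_simp
    · simp
  have hGd : ∀ u, |u| < δ → HasDerivAt
      (fun u => Real.cos θ * Real.sin (r * u) / (r * Real.cos (θ + r * u)))
      ((Real.cos θ / Real.cos (θ + r * u)) ^ 2) u := by
    intro u hu
    have := (hc u hu).ne'
    have h0 : HasDerivAt (fun u => r * u) r u := by simpa using (hasDerivAt_id u).const_mul r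
    have h1 := (h0.sin.const_mul (Real.cos θ)).div ((h0.const_add θ).cos.const_mul r)
      (mul_ne_zero hr0.ne' this)
    refine h1.congr_deriv ?_
    have h2 : Real.cos θ
        = Real.cos (θ + r * u) * Real.cos (r * u) + Real.sin (θ + r * u) * Real.sin (r * u) := by
      rw [← Real.cos_sub]
      ring_nf
    rw [div_pow, mul_pow]
    field_simp
    linear_combination -h2
  refine exists_hasMoments_of_density (μ := volume) (w := betaPDFReal a (1 - a))
    (X := fun x => b * (Real.log x - Real.log (1 - x)))
    (m := fun u => Real.cos θ / Real.cos (θ + r * u)) (measurable_betaPDFReal a (1 - a))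
    (hnn ha01.1 ha01.2) (by fun_prop) hδ0 (by simp [hcos.ne']) (fun u hu => ?_) (fun u hu => ?_)
    hGd (fun n => ?_) (by simp) (fun u hu => ?_)
  · simp only [key u hu]
    exact (hI u hu).1.const_mul _
  · simp only [key u hu]
    rw [integral_const_mul, (hI u hu).2, mul_one]
  · exact ContDiffAt.div (by fun_prop) (by fun_prop) (by simp [hr0.ne', hcos.ne'])
  · have hne := (hc u hu).ne'
    have he : eta = r ^ 2 + lam ^ 2 / 4 := by linarith
    have hl : lam * Real.cos θ = 2 * r * Real.sin θ := by
      rw [hsin]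
      field_simp
    have h1 : Real.cos (θ + r * u)
        = Real.cos θ * Real.cos (r * u) - Real.sin θ * Real.sin (r * u) := Real.cos_add _ _
    have h2 := Real.sin_sq_add_cos_sq (r * u)
    rw [he]
    field_simp
    rw [h1]
    generalize Real.cos θ = c at *
    generalize Real.sin θ = s at *
    generalize Real.cos (r * u) = C at *
    generalize Real.sin (r * u) = S at *
    linear_combination (-(4 * r * (c * C - s * S) * S + S ^ 2 * (lam * c + 2 * r * s))) * hl
      - 4 * r ^ 2 * c ^ 2 * h2

open ProbabilityTheory in
/-- The case of two real roots: the negative binomial distribution, and point masses. -/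
theorem exists_hasMoments_of_discrim_pos {α β : ℝ} (hα : α ≠ 0) (h0 : 0 ≤ β / α)
    (h1 : β / α < 1) :
    ∃ (ν : Measure ℝ) (g : ℕ → ℝ), IsRiccatiSeries (α + β) (α * β) g ∧ HasMoments g ν := by
  obtain ⟨q, rfl⟩ : ∃ q, β = α * q := ⟨β / α, by field_simp⟩
  rw [mul_div_cancel_left₀ _ hα] at h0 h1
  set d := α * (1 - q) with hd
  let p : unitInterval := ⟨1 - q, by linarith, by linarith⟩
  have hp : p ≠ 0 := by
    intro h
    have : (1 - q : ℝ) = 0 := congrArg Subtype.val h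
    linarith
  have hp1 : (p : ℝ) = 1 - q := rfl
  obtain ⟨δ, hδ, hz⟩ : ∃ δ > 0, ∀ u : ℝ, |u| < δ → q * Real.exp (u * d) < 1 := by
    have hcont : Continuous fun u : ℝ => q * Real.exp (u * d) := by fun_prop
    have := hcont.continuousAt.eventually (eventually_lt_nhds (a := q * Real.exp (0 * d)) (b := 1)
      (by simpa))
    obtain ⟨δ, hδ, h⟩ := Metric.eventually_nhds_iff.1 this
    exact ⟨δ, hδ, fun u hu => h (by simpa using hu)⟩
  have hterm : ∀ u (k : ℕ), (1 - (p : ℝ)) ^ k * p * Real.exp (u * (d * (k + 1 / 2)))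
      = ((1 - q) * Real.exp (u * d / 2)) * (q * Real.exp (u * d)) ^ k := by
    intro u k
    rw [hp1, mul_pow, ← Real.exp_nat_mul, sub_sub_cancel,
      show u * (d * (k + 1 / 2)) = u * d / 2 + k * (u * d) by ring, Real.exp_add]
    ring
  have hgeom : ∀ u, |u| < δ → HasSum
      (fun k : ℕ => (1 - (p : ℝ)) ^ k * p * Real.exp (u * (d * (k + 1 / 2))))
      ((1 - q) * Real.exp (u * d / 2) * (1 - q * Real.exp (u * d))⁻¹) := by
    intro u hu
    simp only [hterm]
    exact (hasSum_geometric_of_lt_one (by positivity) (hz u hu)).mul_left _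
  have hint : ∀ u, |u| < δ → Integrable (fun k : ℕ => Real.exp (u * (d * (k + 1 / 2))))
      (geometricMeasure p) := by
    intro u hu
    rw [integrable_geometricMeasure_iff hp]
    simpa using (hgeom u hu).summable
  -- The shift by 1/2 gives each of the two independent summands half of the factor e^{ud} in m(u)².
  -- For q = 0 the sum is the constant d = α.
  refine exists_hasMoments_of_mgf (μ := geometricMeasure p) (X := fun k => d * ((k : ℝ) + 1 / 2))
    (m := fun u => (1 - q) * Real.exp (u * d / 2) * (1 - q * Real.exp (u * d))⁻¹)
    (G := fun u => (Real.exp (u * d) - 1) / (α * (1 - q * Real.exp (u * d))))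
    (by fun_prop) hδ hint (fun u hu => ?_) (fun u hu => ?_) (fun n => ?_) (by simp)
    (fun u hu => ?_)
  · exact (hasSum_integral_geometricMeasure hp (hint u hu)).unique (by simpa using hgeom u hu)
  · have hne : 1 - q * Real.exp (u * d) ≠ 0 := (sub_pos.2 (hz u hu)).ne'
    have hE : HasDerivAt (fun u => Real.exp (u * d)) (Real.exp (u * d) * d) u := by
      simpa using ((hasDerivAt_id u).mul_const d).exp
    have h2 := (hE.sub_const 1).div (((hE.const_mul q).const_sub 1).const_mul α)
      (mul_ne_zero hα hne)
    refine h2.congr_deriv ?_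
    have h3 : Real.exp (u * d / 2) ^ 2 = Real.exp (u * d) := by
      rw [← Real.exp_nat_mul]
      ring_nf
    simp only [mul_pow, h3]
    generalize Real.exp (u * d) = z at *
    rw [hd]
    field_simp
    ring
  · exact ContDiffAt.div (by fun_prop) (by fun_prop)
      (mul_ne_zero hα (by simpa using (sub_pos.2 h1).ne'))
  · have hne : 1 - q * Real.exp (u * d) ≠ 0 := (sub_pos.2 (hz u hu)).ne'
    have h3 : Real.exp (u * d / 2) ^ 2 = Real.exp (u * d) := by
      rw [← Real.exp_nat_mul]
      ring_nf
    simp only [mul_pow, h3]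
    generalize Real.exp (u * d) = z at *
    field_simp
    ring

theorem exists_hasMoments (lam : ℝ) {eta : ℝ} (heta : 0 ≤ eta) :
    ∃ (ν : Measure ℝ) (g : ℕ → ℝ), IsRiccatiSeries lam eta g ∧ HasMoments g ν := by
  rcases lt_trichotomy (lam ^ 2) (4 * eta) with h | h | h
  · exact exists_hasMoments_of_discrim_neg h
  · exact exists_hasMoments_of_discrim_eq_zero h
  -- Factor 1 + λg + ηg² = (1 + αg)(1 + βg), with α the one of larger modulus; αβ = η ≥ 0 forces β/α
  -- ≥ 0.
  · obtain ⟨α, β, hα, hq0, hq1, rfl, rfl⟩ : ∃ α β : ℝ, α ≠ 0 ∧ 0 ≤ β / α ∧ β / α < 1 ∧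
        lam = α + β ∧ eta = α * β := by
      set r := Real.sqrt (lam ^ 2 - 4 * eta) with hr
      have hr0 : 0 < r := Real.sqrt_pos.2 (by linarith)
      have hr2 : r ^ 2 = lam ^ 2 - 4 * eta := Real.sq_sqrt (by linarith)
      have hrl : r ≤ |lam| := abs_le_of_sq_le_sq' (by rw [sq_abs]; linarith) (abs_nonneg _) |>.2
      rcases le_total 0 lam with hl | hl
      · rw [abs_of_nonneg hl] at hrl
        have hα : 0 < (lam + r) / 2 := by linarith
        refine ⟨(lam + r) / 2, (lam - r) / 2, hα.ne', div_nonneg (by linarith) hα.le, ?_,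
          by ring, by linarith⟩
        rw [div_lt_one hα]
        linarith
      · rw [abs_of_nonpos hl] at hrl
        have hα : (lam - r) / 2 < 0 := by linarith
        refine ⟨(lam - r) / 2, (lam + r) / 2, hα.ne,
          div_nonneg_of_nonpos (by linarith) hα.le, ?_, by ring, by linarith⟩
        rw [div_lt_one_of_neg hα]
        linarith
    exact exists_hasMoments_of_discrim_pos hα hq0 hq1

/-! ### The series g(∂) acting on sequences of derivatives -/

/-- The factor k + 1 on the left of the recursion absorbs the k + 1 terms of the convolution. -/
theorem IsRiccatiSeries.abs_le {lam eta : ℝ} {g : ℕ → ℝ} (hg : IsRiccatiSeries lam eta g)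
    (k : ℕ) : |g k| ≤ (1 + |lam| + |eta|) ^ k := by
  set C : ℝ := 1 + |lam| + |eta| with hC
  have hC1 : 1 ≤ C := by linarith [abs_nonneg lam, abs_nonneg eta]
  have hC0 : 0 ≤ C := by linarith
  induction k using Nat.strong_induction_on with
  | _ k ih =>
    cases k with
    | zero => simp [hg.zero]
    | succ k =>
      have h1 : |∑ i ∈ Finset.range (k + 1), g i * g (k - i)| ≤ (k + 1) * C ^ k := by
        refine (Finset.abs_sum_le_sum_abs _ _).trans ?_
        refine (Finset.sum_le_card_nsmul _ _ (C ^ k) fun i hi => ?_).trans (by simp)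
        have hi' : i ≤ k := Nat.lt_succ_iff.1 (Finset.mem_range.1 hi)
        rw [abs_mul]
        calc |g i| * |g (k - i)| ≤ C ^ i * C ^ (k - i) :=
              mul_le_mul (ih i (by omega)) (ih _ (by omega)) (abs_nonneg _) (by positivity)
          _ = C ^ k := by rw [← pow_add, Nat.add_sub_cancel' hi']
      have h2 : ((k : ℝ) + 1) * |g (k + 1)| ≤ ((k : ℝ) + 1) * C ^ (k + 1) := by
        rw [← abs_of_pos (show (0 : ℝ) < k + 1 by positivity), ← abs_mul, hg.succ k]
        rw [abs_of_pos (show (0 : ℝ) < k + 1 by positivity)]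
        have h3 : |if k = 0 then (1 : ℝ) else 0| ≤ (k + 1) * C ^ k := by
          split_ifs with h
          · simp [h]
          · rw [abs_zero]
            positivity
        have h4 : |lam * g k| ≤ |lam| * ((k + 1) * C ^ k) := by
          rw [abs_mul]
          refine mul_le_mul_of_nonneg_left ((ih k (by omega)).trans ?_) (abs_nonneg _)
          exact le_mul_of_one_le_left (by positivity) (by simp)
        have h5 : |eta * ∑ i ∈ Finset.range (k + 1), g i * g (k - i)|
            ≤ |eta| * ((k + 1) * C ^ k) := by
          rw [abs_mul]
          exact mul_le_mul_of_nonneg_left h1 (abs_nonneg _)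
        refine (abs_add_le _ _).trans ((add_le_add ((abs_add_le _ _).trans
          (add_le_add h3 h4)) h5).trans (le_of_eq ?_))
        rw [hC]
        ring
      exact le_of_mul_le_mul_left h2 (by positivity)

/-- Sequences that decrease faster than every geometric progression. -/
def IsRapid (a : ℕ → ℂ) : Prop := ∀ R : ℝ, 0 < R → ∃ K : ℝ, ∀ n, ‖a n‖ * R ^ n ≤ K

/-- The operator `∑ g_k ∂^k` on sequences of Taylor coefficients `a_n = f⁽ⁿ⁾(0)`. -/
noncomputable def lower (g : ℕ → ℝ) (a : ℕ → ℂ) (n : ℕ) : ℂ := ∑' k, (g k : ℂ) * a (n + k)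

section Bounds

variable {g : ℕ → ℝ} {C : ℝ} {a b : ℕ → ℂ}

/-- Measuring decay at a rate R ≥ 2C leaves a spare 2^{-k} after |g_k| ≤ C^k is paid for. All later
convergence rests on this. -/
theorem norm_mul_le_geometric (hC : 0 ≤ C) (hg : ∀ k, |g k| ≤ C ^ k) {R K : ℝ} (hR : 0 < R)
    (hCR : 2 * C ≤ R) (ha : ∀ n, ‖a n‖ * R ^ n ≤ K) (n k : ℕ) :
    ‖(g k : ℂ) * a (n + k)‖ * R ^ n ≤ K * (1 / 2) ^ k := by
  have hK : 0 ≤ K := (by positivity : 0 ≤ ‖a 0‖ * R ^ 0).trans (ha 0)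
  rw [norm_mul, Complex.norm_real, Real.norm_eq_abs]
  have h1 : |g k| * 2 ^ k ≤ R ^ k := by
    calc |g k| * 2 ^ k ≤ C ^ k * 2 ^ k := by gcongr; exact hg k
      _ = (2 * C) ^ k := by rw [mul_pow, mul_comm]
      _ ≤ R ^ k := by gcongr
  rw [one_div, inv_pow, ← div_eq_mul_inv, le_div_iff₀ (by positivity)]
  calc |g k| * ‖a (n + k)‖ * R ^ n * 2 ^ k = (|g k| * 2 ^ k) * (‖a (n + k)‖ * R ^ n) := by ring
    _ ≤ R ^ k * (‖a (n + k)‖ * R ^ n) := by gcongr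
    _ = ‖a (n + k)‖ * R ^ (n + k) := by rw [pow_add]; ring
    _ ≤ K := ha _

theorem summable_lower (hC : 0 ≤ C) (hg : ∀ k, |g k| ≤ C ^ k) (ha : IsRapid a) (n : ℕ) :
    Summable fun k => (g k : ℂ) * a (n + k) := by
  have hR : 0 < 2 * C + 1 := by linarith
  obtain ⟨K, hK⟩ := ha (2 * C + 1) hR
  refine Summable.of_norm_bounded
    ((summable_geometric_two.mul_left K).mul_right ((2 * C + 1) ^ n)⁻¹) fun k => ?_
  rw [← div_eq_mul_inv, le_div_iff₀ (by positivity)]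
  exact norm_mul_le_geometric hC hg hR (by linarith) hK n k

theorem norm_lower_le (hC : 0 ≤ C) (hg : ∀ k, |g k| ≤ C ^ k) {R K : ℝ} (hR : 0 < R)
    (hCR : 2 * C ≤ R) (ha : ∀ n, ‖a n‖ * R ^ n ≤ K) (n : ℕ) :
    ‖lower g a n‖ * R ^ n ≤ 2 * K := by
  have hb : ∀ k, ‖(g k : ℂ) * a (n + k)‖ ≤ K * (1 / 2) ^ k * (R ^ n)⁻¹ := fun k => by
    rw [← div_eq_mul_inv, le_div_iff₀ (by positivity)]
    exact norm_mul_le_geometric hC hg hR hCR ha n k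
  have h1 := tsum_of_norm_bounded ((hasSum_geometric_two.mul_left K).mul_right (R ^ n)⁻¹) hb
  rw [← div_eq_mul_inv, le_div_iff₀ (by positivity)] at h1
  exact h1.trans_eq (mul_comm _ _)

theorem IsRapid.lower (ha : IsRapid a) (hC : 0 ≤ C) (hg : ∀ k, |g k| ≤ C ^ k) :
    IsRapid (lower g a) := by
  intro R hR
  obtain ⟨K, hK⟩ := ha (R + 2 * C) (by linarith)
  refine ⟨2 * K, fun n => le_trans ?_
    (norm_lower_le hC hg (R := R + 2 * C) (by linarith) (by linarith) hK n)⟩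
  gcongr
  linarith

theorem lower_add (hC : 0 ≤ C) (hg : ∀ k, |g k| ≤ C ^ k) (ha : IsRapid a) (hb : IsRapid b)
    (n : ℕ) : lower g (fun m => a m + b m) n = lower g a n + lower g b n := by
  simp only [lower, mul_add]
  exact (summable_lower hC hg ha n).tsum_add (summable_lower hC hg hb n)

theorem lower_const_mul (c : ℂ) (n : ℕ) : lower g (fun m => c * a m) n = c * lower g a n := by
  simp only [lower, mul_left_comm _ c]
  exact tsum_mul_left

/-- D² is the operator of the power series g²: the double series converges absolutely and is
regrouped along antidiagonals. -/
theorem hasSum_lower_lower (hC : 0 ≤ C) (hg : ∀ k, |g k| ≤ C ^ k) (ha : IsRapid a) (n : ℕ) :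
    HasSum (fun m => ((∑ i ∈ Finset.range (m + 1), g i * g (m - i) : ℝ) : ℂ) * a (n + m))
      (lower g (lower g a) n) := by
  have hsum : Summable fun p : ℕ × ℕ => (g p.1 : ℂ) * ((g p.2 : ℂ) * a (n + p.1 + p.2)) := by
    have hR : 0 < 2 * C + 1 := by linarith
    obtain ⟨K, hK⟩ := ha (2 * C + 1) hR
    have hs : Summable fun p : ℕ × ℕ => ((1 / 2 : ℝ) ^ p.1 * (1 / 2 : ℝ) ^ p.2) :=
      summable_mul_of_summable_norm (f := fun k : ℕ => (1 / 2 : ℝ) ^ k)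
        (g := fun k : ℕ => (1 / 2 : ℝ) ^ k)
        (by simpa using summable_geometric_two) (by simpa using summable_geometric_two)
    refine Summable.of_norm_bounded ((hs.mul_left K).mul_right ((2 * C + 1) ^ n)⁻¹) fun p => ?_
    rw [← div_eq_mul_inv, le_div_iff₀ (by positivity)]
    have h1 : ∀ m, ‖(g p.2 : ℂ) * a (m + p.2)‖ * (2 * C + 1) ^ m ≤ K * (1 / 2) ^ p.2 :=
      fun m => norm_mul_le_geometric hC hg hR (by linarith) hK m p.2
    exact (norm_mul_le_geometric (a := fun m => (g p.2 : ℂ) * a (m + p.2)) hC hg hR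
      (by linarith) h1 n p.1).trans_eq (by ring)
  have h1 : HasSum (fun p : ℕ × ℕ => (g p.1 : ℂ) * ((g p.2 : ℂ) * a (n + p.1 + p.2)))
      (lower g (lower g a) n) := by
    convert hsum.hasSum using 1
    rw [hsum.tsum_prod]
    simp only [lower, tsum_mul_left]
  rw [← Finset.HasAntidiagonal.sigmaAntidiagonalEquivProd.hasSum_iff] at h1
  convert h1.sigma fun m => hasSum_fintype _ using 1
  ext m
  have h2 := Finset.sum_finset_coe
    (fun q : ℕ × ℕ => (g q.1 : ℂ) * ((g q.2 : ℂ) * a (n + q.1 + q.2)))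
    (Finset.HasAntidiagonal.antidiagonal m)
  refine Eq.trans ?_ h2.symm
  rw [Finset.Nat.sum_antidiagonal_eq_sum_range_succ
    (fun i j => (g i : ℂ) * ((g j : ℂ) * a (n + i + j)))]
  push_cast
  rw [Finset.sum_mul]
  refine Finset.sum_congr rfl fun i hi => ?_
  have hi' : i ≤ m := Nat.lt_succ_iff.1 (Finset.mem_range.1 hi)
  rw [show n + i + (m - i) = n + m by omega, mul_assoc]

end Bounds

/-! ### Commutation with x, and lowering of Meixner families -/

/-- The derivatives at `0` of a polynomial. -/
noncomputable def coeffs (p : ℝ[X]) (n : ℕ) : ℂ := ((n.factorial * p.coeff n : ℝ) : ℂ)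

theorem isRapid_coeffs (p : ℝ[X]) : IsRapid (coeffs p) := by
  intro R hR
  refine ⟨∑ n ∈ p.support, ‖coeffs p n‖ * R ^ n, fun n => ?_⟩
  by_cases hn : n ∈ p.support
  · exact Finset.single_le_sum (f := fun n => ‖coeffs p n‖ * R ^ n)
      (fun i _ => by positivity) hn
  · rw [coeffs, notMem_support_iff.1 hn]
    simp only [mul_zero, Complex.ofReal_zero, norm_zero, zero_mul]
    exact Finset.sum_nonneg fun i _ => by positivity

theorem coeffs_add (p q : ℝ[X]) : coeffs (p + q) = fun n => coeffs p n + coeffs q n := by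
  ext n
  simp [coeffs, mul_add]

theorem coeffs_C_mul (c : ℝ) (p : ℝ[X]) : coeffs (C c * p) = fun n => (c : ℂ) * coeffs p n := by
  ext n
  simp [coeffs, mul_left_comm]

theorem coeffs_X_mul (p : ℝ[X]) (n : ℕ) : coeffs (X * p) n = n * coeffs p (n - 1) := by
  cases n with
  | zero => simp [coeffs]
  | succ n =>
    simp only [coeffs, coeff_X_mul, Nat.factorial_succ, Nat.add_sub_cancel]
    push_cast
    ring

theorem coeffs_one (n : ℕ) : coeffs 1 n = if n = 0 then 1 else 0 := by
  by_cases h : n = 0 <;> simp [coeffs, coeff_one, h]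

section Commutation

variable {lam eta : ℝ} {g : ℕ → ℝ}

/-- The commutation relation `[D, x] = 1 + lam D + eta D²`. -/
theorem lower_coeffs_X_mul (hg : IsRiccatiSeries lam eta g) (p : ℝ[X]) (n : ℕ) :
    lower g (coeffs (X * p)) n = n * lower g (coeffs p) (n - 1) + coeffs p n
      + lam * lower g (coeffs p) n + eta * lower g (lower g (coeffs p)) n := by
  have hC : (0 : ℝ) ≤ 1 + |lam| + |eta| := by positivity
  have ha := isRapid_coeffs p
  have hs := summable_lower hC hg.abs_le (isRapid_coeffs (X * p)) n
  -- The (n+k)-th derivative of xp at 0 is (n + k) p^{(n+k-1)}(0). The summand n yields x D, and the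
  -- summand k yields g'(∂), to which the Riccati recursion applies. Truncated subtraction is
  -- harmless because the factors n and k vanish there.
  have h1 : HasSum (fun k => (n : ℂ) * ((g k : ℂ) * coeffs p (n - 1 + k)))
      (n * lower g (coeffs p) (n - 1)) :=
    (summable_lower hC hg.abs_le ha (n - 1)).hasSum.mul_left _
  have h2 : HasSum (fun k : ℕ => ((((k : ℝ) + 1) * g (k + 1) : ℝ) : ℂ) * coeffs p (n + k))
      (coeffs p n + lam * lower g (coeffs p) n + eta * lower g (lower g (coeffs p)) n) := by
    have e1 : HasSum (fun k => if k = 0 then coeffs p n else 0) (coeffs p n) :=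
      hasSum_ite_eq 0 _
    have e2 : HasSum _ ((lam : ℂ) * lower g (coeffs p) n) :=
      (summable_lower hC hg.abs_le ha n).hasSum.mul_left (lam : ℂ)
    have e3 := (hasSum_lower_lower hC hg.abs_le ha n).mul_left (eta : ℂ)
    convert (e1.add e2).add e3 using 1
    ext k
    rw [hg.succ k]
    split_ifs with h
    · subst h
      push_cast
      ring_nf
    · push_cast
      ring_nf
  have h3 : HasSum (fun k : ℕ => ((k * g k : ℝ) : ℂ) * coeffs p (n + k - 1))
      (coeffs p n + lam * lower g (coeffs p) n + eta * lower g (lower g (coeffs p)) n) := by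
    rw [← hasSum_nat_add_iff' 1]
    simpa using h2
  rw [add_assoc, add_assoc, ← add_assoc (coeffs p n)]
  refine HasSum.tsum_eq ?_
  convert h1.add h3 using 1
  ext k
  rw [coeffs_X_mul]
  cases n with
  | zero =>
    push_cast
    ring
  | succ n =>
    rw [show n + 1 + k - 1 = n + 1 - 1 + k by omega]
    push_cast
    ring

/-- Monic polynomials with `x p_n = p_{n+1} + (lam n + c) p_n + n (d + eta (n - 1)) p_{n-1}`. -/
structure HasMeixnerRecurrence (lam eta c d : ℝ) (p : ℕ → ℝ[X]) : Prop where
  zero : p 0 = 1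
  X_mul : ∀ n : ℕ, X * p n = p (n + 1) + Polynomial.C (lam * n + c) * p n
    + Polynomial.C (n * (d + eta * (n - 1))) * p (n - 1)

theorem hasMeixnerRecurrence_P (lam eta : ℝ) : HasMeixnerRecurrence lam eta 0 1 (P lam eta) := by
  refine ⟨rfl, fun n => ?_⟩
  cases n with
  | zero => simp [P]
  | succ n =>
    simp only [P, Nat.add_sub_cancel]
    push_cast
    rw [show (n : ℝ) + 1 - 1 = n by ring, add_zero]
    ring

theorem hasMeixnerRecurrence_Q (lam eta : ℝ) :
    HasMeixnerRecurrence lam eta lam (2 * eta) (Q lam eta) := by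
  refine ⟨rfl, fun n => ?_⟩
  cases n with
  | zero => simp [Q]
  | succ n =>
    simp only [Q, Nat.add_sub_cancel]
    push_cast
    rw [show lam * ((n : ℝ) + 1) + lam = lam * (n + 2) by ring,
      show ((n : ℝ) + 1) * (2 * eta + eta * (n + 1 - 1)) = eta * (n + 1) * (n + 2) by ring]
    ring

/-- Apply D to the recurrence, commute it past x, and use induction. The commutator λD + ηD² exactly
compensates the growth of the coefficients from index n to n + 1, so c and d play no role. -/
theorem lower_coeffs_eq {c d : ℝ} {p : ℕ → ℝ[X]} (hg : IsRiccatiSeries lam eta g)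
    (hp : HasMeixnerRecurrence lam eta c d p) (n : ℕ) :
    lower g (coeffs (p n)) = fun m => (n : ℂ) * coeffs (p (n - 1)) m := by
  have hC : (0 : ℝ) ≤ 1 + |lam| + |eta| := by positivity
  have hstep : ∀ n m, lower g (coeffs (p (n + 1))) m
      = m * lower g (coeffs (p n)) (m - 1) + coeffs (p n) m
      + lam * lower g (coeffs (p n)) m + eta * lower g (lower g (coeffs (p n))) m
      - (lam * n + c) * lower g (coeffs (p n)) m
      - n * (d + eta * (n - 1)) * lower g (coeffs (p (n - 1))) m := by
    intro n m
    rw [← lower_coeffs_X_mul hg, hp.X_mul, coeffs_add,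
      lower_add hC hg.abs_le (isRapid_coeffs _) (isRapid_coeffs _), coeffs_add,
      lower_add hC hg.abs_le (isRapid_coeffs _) (isRapid_coeffs _), coeffs_C_mul, coeffs_C_mul,
      lower_const_mul, lower_const_mul]
    push_cast
    ring
  have h0 : lower g (coeffs (p 0)) = fun _ => 0 := by
    ext m
    rw [hp.zero, lower, tsum_eq_single 0]
    · simp [hg.zero]
    · intro k hk
      rw [coeffs_one, if_neg (by omega), mul_zero]
  have hzero : ∀ m, lower g (fun _ => 0) m = 0 := fun m => by simp [lower]
  have h1 : lower g (coeffs (p 1)) = fun m => coeffs (p 0) m := by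
    ext m
    rw [hstep 0 m, h0, hzero]
    simp
  induction n using Nat.twoStepInduction with
  | zero => simpa using h0
  | one => simpa using h1
  | more n ih0 ih1 =>
    ext m
    have hX : coeffs (X * p n) m = coeffs (p (n + 1)) m + (lam * n + c) * coeffs (p n) m
        + n * (d + eta * (n - 1)) * coeffs (p (n - 1)) m := by
      rw [hp.X_mul, coeffs_add, coeffs_add, coeffs_C_mul, coeffs_C_mul]
      push_cast
      ring
    rw [coeffs_X_mul] at hX
    rw [hstep (n + 1) m, ih1]
    simp only [Nat.add_sub_cancel, lower_const_mul, ih0]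
    rw [show n + 2 - 1 = n + 1 by omega]
    push_cast
    -- All terms except p_{n+1} assemble to n + 1 times the recurrence at n, giving (n+1) p_{n+1} +
    -- p_{n+1}.
    linear_combination ((n : ℂ) + 1) * hX

end Commutation

/-! ### Entire functions of minimal type as rapidly decreasing sequences -/

/-- The function with derivatives `a n` at `0`. -/
noncomputable def ofSeq (a : ℕ → ℂ) (z : ℂ) : ℂ := ∑' n, a n / n.factorial * z ^ n

theorem IsRapid.shift {a : ℕ → ℂ} (ha : IsRapid a) : IsRapid fun n => a (n + 1) := by
  intro R hR
  obtain ⟨K, hK⟩ := ha R hR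
  refine ⟨K / R, fun n => ?_⟩
  rw [le_div_iff₀ hR]
  simpa [pow_succ, mul_assoc] using hK (n + 1)

theorem IsRapid.congr {a b : ℕ → ℂ} (ha : IsRapid a) (h : ∀ n, a n = b n) : IsRapid b :=
  funext h ▸ ha

theorem IsRapid.shiftN {a : ℕ → ℂ} (ha : IsRapid a) (k : ℕ) : IsRapid fun n => a (n + k) := by
  induction k with
  | zero => exact ha
  | succ k ih => exact ih.shift.congr fun n => by rw [add_right_comm, add_assoc]

theorem norm_term_le {a : ℕ → ℂ} {R K : ℝ} (hR : 0 < R) (hK : ∀ n, ‖a n‖ * R ^ n ≤ K) {z : ℂ}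
    {r : ℝ} (hz : ‖z‖ ≤ r) (n : ℕ) :
    ‖a n / n.factorial * z ^ n‖ ≤ K * ((r / R) ^ n / n.factorial) := by
  have h := hK n
  rw [norm_mul, norm_div, norm_pow, Complex.norm_natCast, div_pow]
  calc ‖a n‖ / n.factorial * ‖z‖ ^ n ≤ ‖a n‖ / n.factorial * r ^ n := by gcongr
    _ = ‖a n‖ * R ^ n * (r ^ n / R ^ n / n.factorial) := by field_simp
    _ ≤ K * (r ^ n / R ^ n / n.factorial) := by
      have : 0 ≤ r := (norm_nonneg z).trans hz
      gcongr

theorem hasSum_bound (K x : ℝ) :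
    HasSum (fun n : ℕ => K * (x ^ n / n.factorial)) (K * Real.exp x) := by
  rw [Real.exp_eq_exp_ℝ]
  exact (NormedSpace.expSeries_div_hasSum_exp x).mul_left K

theorem hasSum_ofSeq {a : ℕ → ℂ} (ha : IsRapid a) (z : ℂ) :
    HasSum (fun n => a n / n.factorial * z ^ n) (ofSeq a z) := by
  obtain ⟨K, hK⟩ := ha 1 one_pos
  exact (Summable.of_norm_bounded (hasSum_bound K (‖z‖ / 1)).summable
    (norm_term_le one_pos hK le_rfl)).hasSum

theorem norm_ofSeq_le {a : ℕ → ℂ} {R K : ℝ} (hR : 0 < R) (hK : ∀ n, ‖a n‖ * R ^ n ≤ K) (z : ℂ) :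
    ‖ofSeq a z‖ ≤ K * Real.exp (‖z‖ / R) :=
  tsum_of_norm_bounded (hasSum_bound K (‖z‖ / R)) (norm_term_le hR hK le_rfl)

theorem hasDerivAt_ofSeq {a : ℕ → ℂ} (ha : IsRapid a) (z : ℂ) :
    HasDerivAt (ofSeq a) (ofSeq (fun n => a (n + 1)) z) z := by
  obtain ⟨K, hK⟩ := ha.shift 1 one_pos
  have h := hasDerivAt_tsum_of_isPreconnected
    (u := fun n : ℕ => K * ((‖z‖ + 1) ^ n / n.factorial))
    (g := fun n z => a (n + 1) / (n + 1).factorial * z ^ (n + 1))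
    (g' := fun n z => a (n + 1) / n.factorial * z ^ n)
    (t := Metric.ball 0 (‖z‖ + 1)) (y₀ := z) (y := z)
    (hasSum_bound K (‖z‖ + 1)).summable Metric.isOpen_ball (convex_ball _ _).isPreconnected
    (fun n y _ => ?_) (fun n y hy => ?_) (by simp) ?_ (by simp)
  · have h2 : ofSeq a = fun z => a 0 + ∑' n, a (n + 1) / (n + 1).factorial * z ^ (n + 1) := by
      ext z
      rw [ofSeq, (hasSum_ofSeq ha z).summable.tsum_eq_zero_add]
      simp
    rw [h2]
    exact h.const_add _
  · have h1 := (hasDerivAt_pow (n + 1) y).const_mul (a (n + 1) / ((n + 1).factorial : ℂ))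
    refine h1.congr_deriv ?_
    rw [Nat.factorial_succ]
    have : ((n : ℂ) + 1) ≠ 0 := Nat.cast_add_one_ne_zero n
    push_cast
    field_simp
  · have hy' : ‖y‖ ≤ ‖z‖ + 1 := by simpa using (Metric.mem_ball.1 hy).le
    simpa using norm_term_le (a := fun n => a (n + 1)) one_pos hK hy' n
  · exact (summable_nat_add_iff 1).2 (hasSum_ofSeq ha z).summable

theorem iteratedDeriv_ofSeq {a : ℕ → ℂ} (ha : IsRapid a) (k : ℕ) :
    iteratedDeriv k (ofSeq a) = ofSeq fun n => a (n + k) := by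
  induction k with
  | zero => simp
  | succ k ih =>
    rw [iteratedDeriv_succ, ih]
    ext z
    rw [(hasDerivAt_ofSeq (ha.shiftN k) z).deriv]
    simp only [add_right_comm, add_assoc]

theorem ofSeq_zero (a : ℕ → ℂ) : ofSeq a 0 = a 0 := by
  rw [ofSeq, tsum_eq_single 0 (fun n hn => by simp [hn])]
  simp

theorem differentiable_ofSeq {a : ℕ → ℂ} (ha : IsRapid a) : Differentiable ℂ (ofSeq a) :=
  fun z => (hasDerivAt_ofSeq ha z).differentiableAt

theorem isEntireMin_ofSeq {a : ℕ → ℂ} (ha : IsRapid a) : IsEntireMin (ofSeq a) := by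
  refine ⟨differentiable_ofSeq ha, fun ε hε => ?_⟩
  obtain ⟨K, hK⟩ := ha ε⁻¹ (inv_pos.2 hε)
  refine ⟨|K| + 1, by positivity, fun z => (norm_ofSeq_le (inv_pos.2 hε) hK z).trans ?_⟩
  rw [div_inv_eq_mul, mul_comm ‖z‖]
  gcongr
  linarith [le_abs_self K]

theorem iteratedDeriv_comp_ofReal {F : ℂ → ℂ} (hF : Differentiable ℂ F) (n : ℕ) :
    iteratedDeriv n (fun x : ℝ => F x) = fun x : ℝ => iteratedDeriv n F x := by
  induction n with
  | zero => simp
  | succ n ih =>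
    ext x
    rw [iteratedDeriv_succ, ih, iteratedDeriv_succ]
    have hd : Differentiable ℂ (iteratedDeriv n F) :=
      hF.contDiff.differentiable_iteratedDeriv n (WithTop.coe_lt_top _)
    exact ((hd x).hasDerivAt.comp_ofReal).deriv

/-- The derivatives at `0`. -/
noncomputable def seq (f : EMin) (n : ℕ) : ℂ := iteratedDeriv n (f : ℝ → ℂ) 0

theorem isRapid_of_isEntireMin {F : ℂ → ℂ} (hF : IsEntireMin F) :
    IsRapid fun n => iteratedDeriv n F 0 := by
  intro R hR
  -- Cauchy's estimate on the circle of radius n/ε, with n! ≤ n^n, bounds the n-th derivative by K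
  -- (eε)^n, which is K R^{-n} for this ε.
  set ε := (R * Real.exp 1)⁻¹ with hε
  have hε0 : 0 < ε := by positivity
  obtain ⟨K, hK, hb⟩ := hF.2 ε hε0
  refine ⟨K, fun n => ?_⟩
  rcases Nat.eq_zero_or_pos n with rfl | hn
  · simpa using hb 0
  have hn' : (0 : ℝ) < n := by exact_mod_cast hn
  set r : ℝ := n / ε with hr
  have hr0 : 0 < r := by positivity
  have h1 := Complex.norm_iteratedDeriv_le_of_forall_mem_sphere_norm_le (c := 0)
    (C := K * Real.exp n) n hr0 hF.1.diffContOnCl (fun z hz => by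
      have hz' : ‖z‖ = r := by simpa using hz
      refine (hb z).trans_eq ?_
      rw [hz', hr, mul_div_cancel₀ _ hε0.ne'])
  have h2 : (n.factorial : ℝ) ≤ (n : ℝ) ^ n := by exact_mod_cast Nat.factorial_le_pow n
  calc ‖iteratedDeriv n F 0‖ * R ^ n ≤ n.factorial * (K * Real.exp n) / r ^ n * R ^ n := by gcongr
    _ ≤ (n : ℝ) ^ n * (K * Real.exp n) / r ^ n * R ^ n := by gcongr
    _ = K := by
      have he : Real.exp n = Real.exp 1 ^ n := by rw [← Real.exp_nat_mul, mul_one]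
      rw [hr, hε, he, div_pow, inv_pow, mul_pow]
      field_simp

theorem exists_entire (f : EMin) : ∃ F : ℂ → ℂ, IsEntireMin F ∧ (f : ℝ → ℂ) = (fun x : ℝ => F x) ∧
    seq f = fun n => iteratedDeriv n F 0 := by
  obtain ⟨F, hF, h⟩ := f.2
  have h' : (f : ℝ → ℂ) = fun x : ℝ => F x := funext h
  refine ⟨F, hF, h', ?_⟩
  ext n
  rw [seq, h', iteratedDeriv_comp_ofReal hF.1]
  simp

theorem isRapid_seq (f : EMin) : IsRapid (seq f) := by
  obtain ⟨F, hF, -, h⟩ := exists_entire f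
  rw [h]
  exact isRapid_of_isEntireMin hF

theorem eq_ofSeq_seq (f : EMin) : (f : ℝ → ℂ) = fun x : ℝ => ofSeq (seq f) x := by
  obtain ⟨F, hF, h1, h2⟩ := exists_entire f
  rw [h1, h2]
  ext x
  rw [← Complex.taylorSeries_eq_of_entire hF.1 0 x, ofSeq]
  refine tsum_congr fun n => ?_
  rw [sub_zero, smul_eq_mul, smul_eq_mul]
  ring

/-- The element of `EMin` with given derivatives at `0`. -/
noncomputable def toEMin (a : ℕ → ℂ) (ha : IsRapid a) : EMin :=
  ⟨fun x : ℝ => ofSeq a x, ofSeq a, isEntireMin_ofSeq ha, fun _ => rfl⟩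

theorem seq_toEMin (a : ℕ → ℂ) (ha : IsRapid a) : seq (toEMin a ha) = a := by
  ext n
  change iteratedDeriv n (fun x : ℝ => ofSeq a x) 0 = a n
  rw [iteratedDeriv_comp_ofReal (differentiable_ofSeq ha), iteratedDeriv_ofSeq ha]
  simp [ofSeq_zero]

theorem seq_injective : Function.Injective seq := by
  intro f h e
  ext1
  rw [eq_ofSeq_seq f, eq_ofSeq_seq h, e]

theorem contDiff_EMin (f : EMin) (n : ℕ) : ContDiff ℝ n (f : ℝ → ℂ) := by
  obtain ⟨F, hF, h, -⟩ := exists_entire f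
  rw [h]
  exact (hF.1.contDiff.restrict_scalars ℝ).comp Complex.ofRealCLM.contDiff

theorem seq_add (f h : EMin) : seq (f + h) = fun n => seq f n + seq h n := by
  ext n
  change iteratedDeriv n ((f : ℝ → ℂ) + (h : ℝ → ℂ)) 0 = _
  rw [iteratedDeriv_add (contDiff_EMin f n).contDiffAt (contDiff_EMin h n).contDiffAt]
  rfl

theorem seq_smul (c : ℂ) (f : EMin) : seq (c • f) = fun n => c * seq f n := by
  ext n
  change iteratedDeriv n (fun x => c * (f : ℝ → ℂ) x) 0 = _
  rw [iteratedDeriv_const_mul_field]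
  rfl

theorem seq_ofPolynomial (p : ℝ[X]) : seq (ofPolynomial p) = coeffs p := by
  have h : ofPolynomial p = toEMin (coeffs p) (isRapid_coeffs p) := by
    ext x
    change ((p.eval x : ℝ) : ℂ) = ofSeq (coeffs p) x
    rw [ofSeq, tsum_eq_sum (s := p.support), eval_eq_sum, Polynomial.sum]
    · push_cast
      refine Finset.sum_congr rfl fun n _ => ?_
      have : (n.factorial : ℂ) ≠ 0 := Nat.cast_ne_zero.2 n.factorial_ne_zero
      simp only [coeffs]
      push_cast
      field_simp
    · intro n hn
      simp [coeffs, notMem_support_iff.1 hn]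
  rw [h, seq_toEMin]

theorem N_eq (q : ℕ) (f : EMin) : N q f = ∑' n : ℕ, ‖seq f n‖ₑ ^ 2 * 2 ^ (n * q) := by
  refine tsum_congr fun n => ?_
  rw [← mul_pow]
  congr 2
  have h : (n.factorial : ℝ≥0∞) = ‖(n.factorial : ℂ)‖ₑ := by
    rw [← ofReal_norm, Complex.norm_natCast, ENNReal.ofReal_natCast]
  rw [h, ← enorm_mul, div_mul_cancel₀ _ (Nat.cast_ne_zero.2 n.factorial_ne_zero)]
  rfl

/-! ### The lowering operator: existence and continuity -/

variable {lam eta : ℝ} {g : ℕ → ℝ}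

theorem IsRiccatiSeries.isRapid_lower (hg : IsRiccatiSeries lam eta g) {a : ℕ → ℂ}
    (ha : IsRapid a) : IsRapid (lower g a) :=
  ha.lower (by positivity) hg.abs_le

/-- The operator `∑ g_k ∂^k` on `EMin`. -/
noncomputable def lowerOp (hg : IsRiccatiSeries lam eta g) : EMin →ₗ[ℂ] EMin where
  toFun f := toEMin (lower g (seq f)) (hg.isRapid_lower (isRapid_seq f))
  map_add' f h := by
    apply seq_injective
    rw [seq_toEMin, seq_add f h, seq_add, seq_toEMin, seq_toEMin]
    ext n
    exact lower_add (by positivity) hg.abs_le (isRapid_seq f) (isRapid_seq h) n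
  map_smul' c f := by
    apply seq_injective
    rw [RingHom.id_apply, seq_toEMin, seq_smul c f, seq_smul, seq_toEMin]
    ext n
    exact lower_const_mul c n

theorem seq_lowerOp (hg : IsRiccatiSeries lam eta g) (f : EMin) :
    seq (lowerOp hg f) = lower g (seq f) :=
  seq_toEMin _ (hg.isRapid_lower (isRapid_seq f))

theorem enorm_sq_eq (z : ℂ) : ‖z‖ₑ ^ 2 = ENNReal.ofReal (‖z‖ ^ 2) := by
  rw [← ofReal_norm, ENNReal.ofReal_pow (norm_nonneg z)]

theorem enorm_seq_le_N (q n : ℕ) (f : EMin) : ‖seq f n‖ₑ ^ 2 * 2 ^ (n * q) ≤ N q f := by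
  rw [N_eq]
  exact ENNReal.le_tsum n

theorem lowerOp_continuous (hg : IsRiccatiSeries lam eta g) (q : ℕ) :
    ∃ r : ℕ, ∃ K : ℝ≥0, ∀ f : EMin, N q (lowerOp hg f) ≤ K * N r f := by
  set C : ℝ := 1 + |lam| + |eta| with hC
  have hC0 : 0 ≤ C := by positivity
  obtain ⟨s0, hs0⟩ := pow_unbounded_of_one_lt (2 * C) (one_lt_two : (1 : ℝ) < 2)
  -- 2^s ≥ 2C is what `norm_lower_le` needs, and 2s ≥ q + 1 leaves a factor 2^{-n} after the weight
  -- 2^{nq}. The constant 8 is 4 = 2² from that bound times ∑ 2^{-n} = 2.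
  set s := s0 + q + 1 with hs
  have hsC : 2 * C ≤ 2 ^ s := hs0.le.trans (pow_le_pow_right₀ one_le_two (by omega))
  refine ⟨2 * s, 8, fun f => ?_⟩
  by_cases htop : N (2 * s) f = ⊤
  · rw [htop, ENNReal.mul_top (by norm_num)]
    exact le_top
  set M := (N (2 * s) f).toReal with hM
  have hM0 : 0 ≤ M := ENNReal.toReal_nonneg
  have hMe : N (2 * s) f = ENNReal.ofReal M := (ENNReal.ofReal_toReal htop).symm
  have h1 : ∀ n, ‖seq f n‖ * ((2 : ℝ) ^ s) ^ n ≤ Real.sqrt M := by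
    intro n
    refine Real.le_sqrt_of_sq_le ?_
    have h := enorm_seq_le_N (2 * s) n f
    rw [hMe, enorm_sq_eq, show (2 : ℝ≥0∞) = ENNReal.ofReal 2 by simp,
      ← ENNReal.ofReal_pow zero_le_two, ← ENNReal.ofReal_mul (by positivity),
      ENNReal.ofReal_le_ofReal_iff hM0] at h
    refine le_of_eq_of_le ?_ h
    rw [mul_pow, ← pow_mul, ← pow_mul]
    ring_nf
  have h2 : ∀ n, ‖lower g (seq f) n‖ ^ 2 * 2 ^ (n * q) ≤ 4 * M * (1 / 2) ^ n := by
    intro n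
    have h := norm_lower_le hC0 hg.abs_le (by positivity) hsC h1 n
    have h' := pow_le_pow_left₀ (by positivity) h 2
    rw [mul_pow, mul_pow, Real.sq_sqrt hM0] at h'
    rw [one_div, inv_pow, ← div_eq_mul_inv, le_div_iff₀ (by positivity), mul_assoc]
    refine (mul_le_mul_of_nonneg_left ?_ (by positivity)).trans (h'.trans_eq (by norm_num))
    rw [← pow_add, ← pow_mul, ← pow_mul]
    refine pow_le_pow_right₀ one_le_two ?_
    rw [hs]
    nlinarith
  rw [N_eq, seq_lowerOp, hMe]
  have h3 : ∀ n, ‖lower g (seq f) n‖ₑ ^ 2 * 2 ^ (n * q)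
      ≤ ENNReal.ofReal (4 * M * (1 / 2) ^ n) := by
    intro n
    rw [enorm_sq_eq, show (2 : ℝ≥0∞) = ENNReal.ofReal 2 by simp,
      ← ENNReal.ofReal_pow zero_le_two, ← ENNReal.ofReal_mul (by positivity)]
    exact ENNReal.ofReal_le_ofReal (h2 n)
  refine (ENNReal.tsum_le_tsum h3).trans ?_
  rw [← ENNReal.ofReal_tsum_of_nonneg (fun n => by positivity)
    (summable_geometric_two.mul_left _), tsum_mul_left, tsum_geometric_two,
    show ((8 : ℝ≥0) : ℝ≥0∞) = ENNReal.ofReal 8 by simp, ← ENNReal.ofReal_mul (by norm_num)]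
  exact ENNReal.ofReal_le_ofReal (by linarith)

theorem lowerOp_ofPolynomial {c d : ℝ} {p : ℕ → ℝ[X]} (hg : IsRiccatiSeries lam eta g)
    (hp : HasMeixnerRecurrence lam eta c d p) (n : ℕ) :
    lowerOp hg (ofPolynomial (p n)) = (n : ℂ) • ofPolynomial (p (n - 1)) := by
  apply seq_injective
  rw [seq_lowerOp, seq_smul, seq_ofPolynomial, seq_ofPolynomial, lower_coeffs_eq hg hp]

theorem isLoweringOperator_lowerOp (hg : IsRiccatiSeries lam eta g) :
    IsLoweringOperator lam eta (lowerOp hg) where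
  lower_zero := by simp [lowerOp_ofPolynomial hg (hasMeixnerRecurrence_P lam eta)]
  lower_succ n := by simp [lowerOp_ofPolynomial hg (hasMeixnerRecurrence_P lam eta)]
  continuous := lowerOp_continuous hg

/-! ### Uniqueness of the lowering operator -/

theorem ofPolynomial_add (p q : ℝ[X]) :
    ofPolynomial (p + q) = ofPolynomial p + ofPolynomial q := by
  ext x
  simp [ofPolynomial]

theorem ofPolynomial_C_mul (c : ℝ) (p : ℝ[X]) :
    ofPolynomial (Polynomial.C c * p) = (c : ℂ) • ofPolynomial p := by
  ext x
  simp [ofPolynomial]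

/-- A property of polynomials that is closed under linear combinations and holds for all `p n`
holds for all polynomials. -/
theorem HasMeixnerRecurrence.induction {c d : ℝ} {p : ℕ → ℝ[X]}
    (hp : HasMeixnerRecurrence lam eta c d p) {motive : ℝ[X] → Prop} (basis : ∀ n, motive (p n))
    (add : ∀ q r, motive q → motive r → motive (q + r))
    (C_mul : ∀ a q, motive q → motive (Polynomial.C a * q)) (q : ℝ[X]) : motive q := by
  have h0 : motive 0 := by simpa using C_mul 0 _ (basis 0)
  let W : Submodule ℝ ℝ[X] :=
    { carrier := {q | motive q}
      zero_mem' := h0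
      add_mem' := fun ha hb => add _ _ ha hb
      smul_mem' := fun a q hq => by
        rw [smul_eq_C_mul]
        exact C_mul a q hq }
  suffices h : Submodule.span ℝ (Set.range p) = ⊤ by
    have h1 : Submodule.span ℝ (Set.range p) ≤ W := by
      rw [Submodule.span_le]
      rintro _ ⟨n, rfl⟩
      exact basis n
    exact h1 (h ▸ Submodule.mem_top)
  -- The span contains p_0 = 1 and, by the recurrence, is stable under multiplication by x, so it
  -- contains all monomials.
  have hX : ∀ q ∈ Submodule.span ℝ (Set.range p), X * q ∈ Submodule.span ℝ (Set.range p) := by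
    intro q hq
    induction hq using Submodule.span_induction with
    | mem x hx =>
      obtain ⟨n, rfl⟩ := hx
      rw [hp.X_mul, ← smul_eq_C_mul, ← smul_eq_C_mul]
      have hm : ∀ n, p n ∈ Submodule.span ℝ (Set.range p) := fun n =>
        Submodule.subset_span ⟨n, rfl⟩
      exact Submodule.add_mem _ (Submodule.add_mem _ (hm _) (Submodule.smul_mem _ _ (hm _)))
        (Submodule.smul_mem _ _ (hm _))
    | zero => simp
    | add x y _ _ hx hy =>
      rw [mul_add]
      exact Submodule.add_mem _ hx hy
    | smul a x _ hx =>
      rw [mul_smul_comm]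
      exact Submodule.smul_mem _ _ hx
  refine Submodule.eq_top_iff'.2 fun q => ?_
  induction q using Polynomial.induction_on' with
  | add q r hq hr => exact Submodule.add_mem _ hq hr
  | monomial n a =>
    have hn : (X : ℝ[X]) ^ n ∈ Submodule.span ℝ (Set.range p) := by
      induction n with
      | zero => rw [pow_zero, ← hp.zero]; exact Submodule.subset_span ⟨0, rfl⟩
      | succ n ih => rw [pow_succ']; exact hX _ ih
    rw [← C_mul_X_pow_eq_monomial, ← smul_eq_C_mul]
    exact Submodule.smul_mem _ _ hn

theorem IsLoweringOperator.eq_on_polynomials {D D' : EMin →ₗ[ℂ] EMin}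
    (hD : IsLoweringOperator lam eta D) (hD' : IsLoweringOperator lam eta D') (p : ℝ[X]) :
    D (ofPolynomial p) = D' (ofPolynomial p) := by
  induction p using (hasMeixnerRecurrence_P lam eta).induction with
  | basis n =>
    cases n with
    | zero => rw [hD.lower_zero, hD'.lower_zero]
    | succ n => rw [hD.lower_succ, hD'.lower_succ]
  | add q r hq hr => rw [ofPolynomial_add, map_add, map_add, hq, hr]
  | C_mul a q hq => rw [ofPolynomial_C_mul, map_smul, map_smul, hq]

/-- The Taylor polynomials at `0`. -/
noncomputable def taylorSum (f : EMin) (n : ℕ) : EMin :=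
  ∑ k ∈ Finset.range n, (seq f k / k.factorial) • ofPolynomial (X ^ k)

theorem seq_sum (s : Finset ℕ) (f : ℕ → EMin) (m : ℕ) :
    seq (∑ k ∈ s, f k) m = ∑ k ∈ s, seq (f k) m := by
  induction s using Finset.cons_induction with
  | empty =>
    have := congrFun (seq_smul 0 0) m
    simpa using this
  | cons a s ha ih => rw [Finset.sum_cons, Finset.sum_cons, seq_add, ← ih]

theorem seq_taylorSum (f : EMin) (n m : ℕ) :
    seq (taylorSum f n) m = if m < n then seq f m else 0 := by
  have hm : (m.factorial : ℂ) ≠ 0 := Nat.cast_ne_zero.2 m.factorial_ne_zero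
  rw [taylorSum, seq_sum]
  simp only [seq_smul, seq_ofPolynomial, coeffs, coeff_X_pow]
  rw [Finset.sum_congr rfl (g := fun k => if m = k then seq f m else 0)]
  · simp [Finset.sum_ite_eq]
  · intro k _
    split_ifs with h
    · subst h
      simp [hm]
    · simp

theorem N_ne_top (q : ℕ) (f : EMin) : N q f ≠ ⊤ := by
  obtain ⟨K, hK⟩ := isRapid_seq f (2 ^ (q + 1)) (by positivity)
  have hK0 : 0 ≤ K := (by positivity : 0 ≤ ‖seq f 0‖ * (2 ^ (q + 1)) ^ 0).trans (hK 0)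
  rw [N_eq]
  have h3 : ∀ n, ‖seq f n‖ₑ ^ 2 * 2 ^ (n * q) ≤ ENNReal.ofReal (K ^ 2 * (1 / 2) ^ n) := by
    intro n
    rw [enorm_sq_eq, show (2 : ℝ≥0∞) = ENNReal.ofReal 2 by simp,
      ← ENNReal.ofReal_pow zero_le_two, ← ENNReal.ofReal_mul (by positivity)]
    refine ENNReal.ofReal_le_ofReal ?_
    rw [one_div, inv_pow, ← div_eq_mul_inv, le_div_iff₀ (by positivity), mul_assoc]
    refine le_trans (mul_le_mul_of_nonneg_left ?_ (by positivity))
      ((mul_pow _ _ 2).symm.le.trans (pow_le_pow_left₀ (by positivity) (hK n) 2))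
    rw [← pow_add, ← pow_mul, ← pow_mul]
    refine pow_le_pow_right₀ one_le_two ?_
    nlinarith
  refine ne_top_of_le_ne_top ?_ (ENNReal.tsum_le_tsum h3)
  rw [← ENNReal.ofReal_tsum_of_nonneg (fun n => by positivity)
    (summable_geometric_two.mul_left _)]
  exact ENNReal.ofReal_ne_top

theorem seq_sub (f h : EMin) (n : ℕ) : seq (f - h) n = seq f n - seq h n := by
  have h1 : f - h = f + (-1 : ℂ) • h := by
    ext x
    simp [sub_eq_add_neg]
  rw [h1, seq_add, seq_smul]
  ring

theorem tendsto_N_sub_taylorSum (q : ℕ) (f : EMin) :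
    Filter.Tendsto (fun n => N q (f - taylorSum f n)) Filter.atTop (nhds 0) := by
  have h := ENNReal.tendsto_sum_nat_add (fun n => ‖seq f n‖ₑ ^ 2 * 2 ^ (n * q))
    (by rw [← N_eq]; exact N_ne_top q f)
  refine h.congr fun n => ?_
  have h2 : ∑ k ∈ Finset.range n, ‖seq (f - taylorSum f n) k‖ₑ ^ 2 * 2 ^ (k * q)
      + ∑' k, ‖seq (f - taylorSum f n) (k + n)‖ₑ ^ 2 * 2 ^ ((k + n) * q)
      = N q (f - taylorSum f n) := by
    rw [N_eq]
    exact Summable.sum_add_tsum_nat_add'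
      (f := fun k => ‖seq (f - taylorSum f n) k‖ₑ ^ 2 * 2 ^ (k * q)) ENNReal.summable
  rw [← h2, Finset.sum_eq_zero, zero_add]
  · refine tsum_congr fun k => ?_
    rw [seq_sub, seq_taylorSum, if_neg (by omega), sub_zero]
  · intro k hk
    rw [seq_sub, seq_taylorSum, if_pos (Finset.mem_range.1 hk), sub_self]
    simp

/-- Taylor polynomials converge in every N_r, and each single coordinate is already controlled by
N_0, whose weights are all 1. -/
theorem IsLoweringOperator.tendsto_seq {D : EMin →ₗ[ℂ] EMin}
    (hD : IsLoweringOperator lam eta D) (f : EMin) (m : ℕ) :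
    Filter.Tendsto (fun n => seq (D (taylorSum f n)) m) Filter.atTop (nhds (seq (D f) m)) := by
  obtain ⟨r, K, hK⟩ := hD.continuous 0
  have h0 : Filter.Tendsto (fun n => ‖seq (D f) m - seq (D (taylorSum f n)) m‖ₑ ^ 2)
      Filter.atTop (nhds 0) := by
    have h1 : Filter.Tendsto (fun n => (K : ℝ≥0∞) * N r (f - taylorSum f n)) Filter.atTop
        (nhds (K * 0)) :=
      ENNReal.Tendsto.const_mul (tendsto_N_sub_taylorSum r f) (Or.inr ENNReal.coe_ne_top)
    rw [mul_zero] at h1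
    refine tendsto_of_tendsto_of_tendsto_of_le_of_le tendsto_const_nhds h1
      (fun n => zero_le) fun n => ?_
    refine le_trans ?_ (hK _)
    rw [← seq_sub, ← map_sub]
    simpa using enorm_seq_le_N 0 m (D (f - taylorSum f n))
  rw [tendsto_iff_norm_sub_tendsto_zero]
  have h2 := (ENNReal.tendsto_toReal ENNReal.zero_ne_top).comp h0
  have h3 := h2.sqrt
  simp only [ENNReal.toReal_zero, Real.sqrt_zero] at h3
  refine h3.congr fun n => ?_
  simp only [Function.comp_apply, ENNReal.toReal_pow, toReal_enorm]
  rw [Real.sqrt_sq (norm_nonneg _), norm_sub_rev]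

theorem IsLoweringOperator.unique {D D' : EMin →ₗ[ℂ] EMin}
    (hD : IsLoweringOperator lam eta D) (hD' : IsLoweringOperator lam eta D') : D = D' := by
  ext1 f
  apply seq_injective
  ext m
  refine tendsto_nhds_unique (hD.tendsto_seq f m) ((hD'.tendsto_seq f m).congr fun n => ?_)
  simp only [taylorSum, map_sum, map_smul, hD.eq_on_polynomials hD']

/-! ### Orthogonality from the recurrence, and moments of orthogonality measures -/

section Functional

variable {c d : ℝ} {p : ℕ → ℝ[X]} {L : ℝ[X] →ₗ[ℝ] ℝ}

/-- Expanding (x p_m) p_n = p_m (x p_n) on both sides writes p_{m+1} p_n through products whose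
smaller index is at most m, which allows induction on the smaller index. -/
theorem HasMeixnerRecurrence.orthogonal_of_lt (hp : HasMeixnerRecurrence lam eta c d p)
    (hL : ∀ n, L (p (n + 1)) = 0) {m n : ℕ} (hmn : m < n) : L (p m * p n) = 0 := by
  induction m using Nat.strong_induction_on generalizing n with
  | _ m ih =>
    cases m with
    | zero =>
      obtain ⟨k, rfl⟩ := Nat.exists_eq_succ_of_ne_zero hmn.ne'
      rw [hp.zero, one_mul]
      exact hL k
    | succ m =>
      have h1 : p (m + 1) * p n = p m * p (n + 1) + (lam * n + c) • (p m * p n)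
          + ((n : ℝ) * (d + eta * (n - 1))) • (p m * p (n - 1))
          - (lam * m + c) • (p m * p n)
          - ((m : ℝ) * (d + eta * (m - 1))) • (p (m - 1) * p n) := by
        have e1 := hp.X_mul m
        have e2 := hp.X_mul n
        simp only [smul_eq_C_mul]
        linear_combination (-p n) * e1 + p m * e2
      -- At m = 0 the truncated index m - 1 is not below m, so the induction hypothesis is
      -- unavailable; the factor m disposes of the term.
      have h2 : (m : ℝ) * L (p (m - 1) * p n) = 0 := by
        rcases Nat.eq_zero_or_pos m with rfl | hm
        · simp
        · rw [ih (m - 1) (by omega) (by omega), mul_zero]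
      rw [h1]
      simp only [map_sub, map_add, map_smul, smul_eq_mul]
      rw [ih m (by omega) (n := n + 1) (by omega), ih m (by omega) (n := n) (by omega),
        ih m (by omega) (n := n - 1) (by omega)]
      linear_combination (-(d + eta * (m - 1))) * h2

theorem HasMeixnerRecurrence.orthogonal (hp : HasMeixnerRecurrence lam eta c d p)
    (hL : ∀ n, L (p (n + 1)) = 0) {m n : ℕ} (hmn : m ≠ n) : L (p m * p n) = 0 := by
  rcases hmn.lt_or_gt with h | h
  · exact hp.orthogonal_of_lt hL h
  · rw [mul_comm]
    exact hp.orthogonal_of_lt hL h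

theorem HasMeixnerRecurrence.map_sq_succ (hp : HasMeixnerRecurrence lam eta c d p)
    (hL : ∀ n, L (p (n + 1)) = 0) (n : ℕ) :
    L (p (n + 1) * p (n + 1)) = (n + 1) * (d + eta * n) * L (p n * p n) := by
  have h1 : p (n + 1) * p (n + 1) = p n * p (n + 2) + (lam * (n + 1) + c) • (p n * p (n + 1))
      + (((n : ℝ) + 1) * (d + eta * n)) • (p n * p n)
      - (lam * n + c) • (p n * p (n + 1))
      - ((n : ℝ) * (d + eta * (n - 1))) • (p (n - 1) * p (n + 1)) := by
    have e1 := hp.X_mul n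
    have e2 := hp.X_mul (n + 1)
    rw [Nat.add_sub_cancel] at e2
    push_cast at e2
    rw [add_sub_cancel_right] at e2
    simp only [smul_eq_C_mul]
    linear_combination (-p (n + 1)) * e1 + p n * e2
  rw [h1]
  simp only [map_sub, map_add, map_smul, smul_eq_mul]
  rw [hp.orthogonal hL (m := n) (n := n + 2) (by omega),
    hp.orthogonal hL (m := n) (n := n + 1) (by omega),
    hp.orthogonal hL (m := n - 1) (n := n + 1) (by omega)]
  ring

theorem HasMeixnerRecurrence.functional_ext (hp : HasMeixnerRecurrence lam eta c d p)
    {L' : ℝ[X] →ₗ[ℝ] ℝ} (hL : ∀ n, L (p (n + 1)) = 0) (hL' : ∀ n, L' (p (n + 1)) = 0)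
    (h1 : L 1 = L' 1) : L = L' := by
  refine LinearMap.ext fun q => ?_
  induction q using hp.induction with
  | basis n =>
    cases n with
    | zero => rw [hp.zero, h1]
    | succ n => rw [hL, hL']
  | add q r hq hr => rw [map_add, map_add, hq, hr]
  | C_mul a q hq => rw [← smul_eq_C_mul, map_smul, map_smul, hq]

end Functional

section Moments

variable {ν : Measure ℝ}

theorem integrable_eval (h : ∀ n : ℕ, Integrable (fun s : ℝ => s ^ n) ν) (p : ℝ[X]) :
    Integrable (fun s => p.eval s) ν := by
  induction p using Polynomial.induction_on' with
  | add p q hp hq =>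
    simp only [eval_add]
    exact hp.add hq
  | monomial n a =>
    simp only [eval_monomial]
    exact (h n).const_mul a

/-- Integration of polynomials. -/
noncomputable def integralFunctional (ν : Measure ℝ)
    (h : ∀ n : ℕ, Integrable (fun s : ℝ => s ^ n) ν) : ℝ[X] →ₗ[ℝ] ℝ where
  toFun p := ∫ s, p.eval s ∂ν
  map_add' p q := by
    simp only [eval_add]
    exact integral_add (integrable_eval h p) (integrable_eval h q)
  map_smul' a p := by
    simp only [eval_smul, smul_eq_mul, RingHom.id_apply]
    exact integral_const_mul a _

theorem integralFunctional_apply (h : ∀ n : ℕ, Integrable (fun s : ℝ => s ^ n) ν) (p : ℝ[X]) :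
    integralFunctional ν h p = ∫ s, p.eval s ∂ν := rfl

/-- On monomials both sides are (n+1)! g_{n+1}: the shift in the moments is exactly the
multiplication by x before D. -/
theorem HasMoments.integralFunctional_eq (hν : HasMoments g ν)
    (hg : IsRiccatiSeries lam eta g) (p : ℝ[X]) :
    ((integralFunctional ν hν.integrable_pow p : ℝ) : ℂ) = lower g (coeffs (X * p)) 0 := by
  induction p using Polynomial.induction_on' with
  | add p q hp hq =>
    rw [map_add, mul_add, coeffs_add, lower_add (by positivity) hg.abs_le (isRapid_coeffs _)
      (isRapid_coeffs _), Complex.ofReal_add, hp, hq]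
  | monomial n a =>
    rw [integralFunctional_apply, ← C_mul_X_pow_eq_monomial, mul_left_comm, coeffs_C_mul,
      lower_const_mul, ← pow_succ', lower, tsum_eq_single (n + 1)]
    · simp only [eval_mul, eval_C, eval_pow, eval_X]
      rw [integral_const_mul, hν.integral_pow]
      simp only [coeffs, zero_add, coeff_X_pow, if_true, mul_one]
      push_cast
      ring
    · intro k hk
      simp [coeffs, coeff_X_pow, hk]

/-- At 0 the commutation relation gives D(xp) = p + λDp + ηD²p. For p = Q_{n+1} this is Q_{n+1} +
λ(n+1)Q_n + ηn(n+1)Q_{n-1} = xQ_n, which vanishes at 0. -/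
theorem HasMoments.integralFunctional_Q_succ (hν : HasMoments g ν)
    (hg : IsRiccatiSeries lam eta g) (n : ℕ) :
    integralFunctional ν hν.integrable_pow (Q lam eta (n + 1)) = 0 := by
  have hQ := hasMeixnerRecurrence_Q lam eta
  have h1 := hν.integralFunctional_eq hg (Q lam eta (n + 1))
  rw [lower_coeffs_X_mul hg, lower_coeffs_eq hg hQ, lower_const_mul, lower_coeffs_eq hg hQ,
    Nat.add_sub_cancel] at h1
  have h2 := coeffs_X_mul (Q lam eta n) 0
  rw [hQ.X_mul, coeffs_add, coeffs_add, coeffs_C_mul, coeffs_C_mul] at h2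
  rw [← Complex.ofReal_eq_zero, h1]
  push_cast at h2 ⊢
  linear_combination h2

theorem HasMoments.isOrthogonalityMeasure (hν : HasMoments g ν)
    (hg : IsRiccatiSeries lam eta g) : IsOrthogonalityMeasure (Q lam eta) ν where
  isProbabilityMeasure := hν.isProbabilityMeasure
  integrable_pow := hν.integrable_pow
  orthogonal m n hmn := by
    have := (hasMeixnerRecurrence_Q lam eta).orthogonal (hν.integralFunctional_Q_succ hg) hmn
    simpa only [integralFunctional_apply, eval_mul] using this

theorem IsOrthogonalityMeasure.integralFunctional_Q_succ
    (hν : IsOrthogonalityMeasure (Q lam eta) ν) (n : ℕ) :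
    integralFunctional ν hν.integrable_pow (Q lam eta (n + 1)) = 0 := by
  have h := hν.orthogonal 0 (n + 1) (by omega)
  rw [(hasMeixnerRecurrence_Q lam eta).zero] at h
  simpa only [integralFunctional_apply, eval_one, one_mul] using h

/-- All measures of orthogonality of `Q` have the same moments. -/
theorem IsOrthogonalityMeasure.hasMoments {ν₀ : Measure ℝ} (hν₀ : HasMoments g ν₀)
    (hg : IsRiccatiSeries lam eta g) (hν : IsOrthogonalityMeasure (Q lam eta) ν) :
    HasMoments g ν := by
  have := hν.isProbabilityMeasure
  have := hν₀.isProbabilityMeasure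
  refine ⟨hν.isProbabilityMeasure, hν.integrable_pow, fun n => ?_⟩
  have h := (hasMeixnerRecurrence_Q lam eta).functional_ext hν.integralFunctional_Q_succ
    (hν₀.integralFunctional_Q_succ hg) (by simp [integralFunctional_apply])
  have h2 := LinearMap.congr_fun h (X ^ n)
  simp only [integralFunctional_apply, eval_pow, eval_X] at h2
  rw [h2, hν₀.integral_pow]

end Moments

/-! ### Absence of an atom at 0 -/

section Atom

variable {ν : Measure ℝ}

/-- The normalized values v_n = Q_n(0)/(η^{n/2} n!) satisfy a recurrence with constant coefficients,
v_{n+2} = -A v_{n+1} - v_n, which conserves the form v_{n+1}² + A v_{n+1} v_n + v_n². Two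
consecutive values therefore cannot both be small. -/
theorem exists_one_le_mul_sq_add_sq (lam : ℝ) (heta : 0 < eta) : ∃ B : ℝ, 0 < B ∧ ∀ n : ℕ,
    1 ≤ B * (((Q lam eta n).eval 0) ^ 2 / (eta ^ n * n.factorial ^ 2)
      + ((Q lam eta (n + 1)).eval 0) ^ 2 / (eta ^ (n + 1) * (n + 1).factorial ^ 2)) := by
  obtain ⟨w, hw, rfl⟩ : ∃ w : ℝ, 0 < w ∧ eta = w ^ 2 :=
    ⟨Real.sqrt eta, Real.sqrt_pos.2 heta, (Real.sq_sqrt heta.le).symm⟩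
  set v : ℕ → ℝ := fun n => (Q lam (w ^ 2) n).eval 0 / (w ^ n * n.factorial) with hv
  set A := lam / w with hA
  have hrec : ∀ n, v (n + 2) = -A * v (n + 1) - v n := by
    intro n
    simp only [hv, hA, Q, eval_sub, eval_mul, eval_X, eval_C, Nat.factorial_succ]
    push_cast
    field_simp
    ring
  have hinv : ∀ n, v (n + 1) ^ 2 + A * v (n + 1) * v n + v n ^ 2 = 1 := by
    intro n
    induction n with
    | zero =>
      simp [hv, hA, Q]
      ring
    | succ n ih =>
      rw [hrec]
      linear_combination ih
  refine ⟨1 + |A|, by positivity, fun n => ?_⟩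
  have e : ∀ n, ((Q lam (w ^ 2) n).eval 0) ^ 2 / ((w ^ 2) ^ n * n.factorial ^ 2) = v n ^ 2 := by
    intro n
    simp only [hv]
    rw [div_pow, mul_pow, ← pow_mul, ← pow_mul, mul_comm n 2]
  rw [e, e]
  have h1 : A * v (n + 1) * v n ≤ |A| * (v n ^ 2 + v (n + 1) ^ 2) := by
    calc A * v (n + 1) * v n ≤ |A * v (n + 1) * v n| := le_abs_self _
      _ = |A| * (|v (n + 1)| * |v n|) := by rw [abs_mul, abs_mul, mul_assoc]
      _ ≤ |A| * (v n ^ 2 + v (n + 1) ^ 2) := by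
        refine mul_le_mul_of_nonneg_left ?_ (abs_nonneg _)
        rw [← sq_abs (v n), ← sq_abs (v (n + 1))]
        nlinarith [sq_nonneg (|v n| - |v (n + 1)|), sq_nonneg (|v n|), sq_nonneg (|v (n + 1)|)]
  linarith [hinv n]

/-- The Christoffel bound `ν {0} ∑ Q_n(0)² / ‖Q_n‖² ≤ 1`. -/
theorem IsOrthogonalityMeasure.sum_mul_measure_zero_le
    (hν : IsOrthogonalityMeasure (Q lam eta) ν) (heta : 0 < eta) (M : ℕ) :
    (∑ n ∈ Finset.range M, ((Q lam eta n).eval 0) ^ 2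
      / (eta ^ n * (n.factorial * (n + 1).factorial))) * ν.real {0} ≤ 1 := by
  have := hν.isProbabilityMeasure
  set L := integralFunctional ν hν.integrable_pow with hL
  have hp := hasMeixnerRecurrence_Q lam eta
  have hLs := hν.integralFunctional_Q_succ
  set h : ℕ → ℝ := fun n => eta ^ n * (n.factorial * (n + 1).factorial) with hh
  have hpos : ∀ n, 0 < h n := fun n => by positivity
  have hnorm : ∀ n, L (Q lam eta n * Q lam eta n) = h n := by
    intro n
    induction n with
    | zero => simp [hL, hh, hp.zero, integralFunctional_apply]
    | succ n ih =>
      rw [hp.map_sq_succ hLs, ih]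
      simp only [hh, Nat.factorial_succ]
      push_cast
      ring
  set q : ℕ → ℝ := fun n => (Q lam eta n).eval 0 with hq
  -- k is the reproducing kernel at 0: k(0) = ∫ k² = S. Keeping only the point 0 in ∫ k² gives S²
  -- ν{0} ≤ S.
  set k : ℝ[X] := ∑ n ∈ Finset.range M, (q n / h n) • Q lam eta n with hk
  set S : ℝ := ∑ n ∈ Finset.range M, q n ^ 2 / h n with hS
  have hk0 : k.eval 0 = S := by
    rw [hk, eval_finsetSum]
    refine Finset.sum_congr rfl fun n _ => ?_
    rw [eval_smul, smul_eq_mul, sq]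
    ring
  have hkk : L (k * k) = S := by
    conv_lhs => rw [hk, Finset.sum_mul, ← hk]
    rw [map_sum]
    refine Finset.sum_congr rfl fun m hm => ?_
    rw [smul_mul_assoc, map_smul, hk, Finset.mul_sum, map_sum, Finset.sum_eq_single m]
    · rw [mul_smul_comm, map_smul, hnorm, smul_eq_mul, smul_eq_mul]
      have := (hpos m).ne'
      field_simp
    · intro n _ hn
      rw [mul_smul_comm, map_smul, hp.orthogonal hLs hn.symm, smul_zero]
    · exact fun h => absurd hm h
  have hle : S ^ 2 * ν.real {0} ≤ S := by
    have hint : Integrable (fun s => (k * k).eval s) ν := integrable_eval hν.integrable_pow _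
    have h1 : ∫ s in ({0} : Set ℝ), (k * k).eval s ∂ν ≤ ∫ s, (k * k).eval s ∂ν :=
      setIntegral_le_integral hint (Filter.Eventually.of_forall fun s => by
        simp only [eval_mul]
        exact mul_self_nonneg _)
    rw [integral_singleton, eval_mul, hk0, ← integralFunctional_apply hν.integrable_pow, ← hL,
      hkk, smul_eq_mul] at h1
    linarith
  have hS0 : 0 ≤ S := Finset.sum_nonneg fun n _ => div_nonneg (sq_nonneg _) (hpos n).le
  rcases hS0.eq_or_lt with h0 | h0
  · rw [← h0]
    simp
  · rw [sq, mul_assoc] at hle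
    exact le_of_mul_le_mul_left (by simpa using hle) h0

/-- For η > 0, Q_n(0)²/‖Q_n‖² = v_n²/(n+1) in the normalization of `exists_one_le_mul_sq_add_sq`, so
an atom would make the harmonic series converge, by the Christoffel bound. For η = 0 the norm of Q_1
is zero, so ν sits at λ ≠ 0. -/
theorem IsOrthogonalityMeasure.measure_zero (hν : IsOrthogonalityMeasure (Q lam eta) ν)
    (heta : 0 ≤ eta) (hne : ¬ (lam = 0 ∧ eta = 0)) : ν {0} = 0 := by
  have := hν.isProbabilityMeasure
  rcases heta.eq_or_lt with h0 | h0
  · subst h0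
    have hlam : lam ≠ 0 := fun h => hne ⟨h, rfl⟩
    have h1 := (hasMeixnerRecurrence_Q lam 0).map_sq_succ hν.integralFunctional_Q_succ 0
    simp only [integralFunctional_apply, zero_add, Q, eval_mul, eval_sub, eval_X, eval_C,
      mul_zero, zero_mul] at h1
    have hint : Integrable (fun s : ℝ => (s - lam) * (s - lam)) ν := by
      refine (integrable_eval hν.integrable_pow ((X - C lam) * (X - C lam))).congr
        (Filter.Eventually.of_forall fun s => ?_)
      simp only [eval_mul, eval_sub, eval_X, eval_C]
    rw [integral_eq_zero_iff_of_nonneg (fun s => mul_self_nonneg _) hint] at h1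
    refine measure_mono_null ?_ (ae_iff.1 h1)
    rintro s rfl
    simpa using hlam
  · by_contra hpos
    obtain ⟨B, hB, hb⟩ := exists_one_le_mul_sq_add_sq lam h0
    have ht : 0 < ν.real {0} := measureReal_nonneg.lt_of_ne' (by
      rw [measureReal_def, ENNReal.toReal_ne_zero]
      exact ⟨hpos, measure_ne_top _ _⟩)
    set q : ℕ → ℝ := fun n => ((Q lam eta n).eval 0) ^ 2
      / (eta ^ n * (n.factorial * (n + 1).factorial)) with hq
    have hq0 : ∀ n, 0 ≤ q n := fun n => by positivity
    have hs : Summable q := summable_of_sum_range_le hq0 (c := 1 / ν.real {0}) fun n => by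
      rw [le_div_iff₀ ht]
      exact hν.sum_mul_measure_zero_le h0 n
    have hs1 : Summable fun n => q (n + 1) := (summable_nat_add_iff 1).2 hs
    have hle : ∀ n : ℕ, 1 / ((n + 2 : ℕ) : ℝ) ≤ B * (q n + q (n + 1)) := by
      intro n
      have e : ∀ n : ℕ, ((Q lam eta n).eval 0) ^ 2 / (eta ^ n * (n.factorial : ℝ) ^ 2)
          = (n + 1) * q n := by
        intro n
        simp only [hq, Nat.factorial_succ]
        push_cast
        field_simp
      have h2 := hb n
      rw [e, e] at h2
      push_cast at h2 ⊢
      rw [div_le_iff₀ (by positivity)]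
      have h3 := mul_nonneg hB.le (hq0 n)
      linarith
    have hs2 : Summable fun n : ℕ => 1 / ((n + 2 : ℕ) : ℝ) :=
      Summable.of_nonneg_of_le (fun n => by positivity) hle ((hs.add hs1).mul_left B)
    exact Real.not_summable_one_div_natCast
      ((summable_nat_add_iff (f := fun n : ℕ => 1 / (n : ℝ)) 2).1 hs2)

end Atom

/-! ### The integral formula -/

/-- Only signed moments are known, so absolute moments are controlled by two neighbouring even
powers, one for |s| ≤ 1 and one for |s| ≥ 1. -/
theorem abs_pow_le (s : ℝ) (k : ℕ) :
    |s| ^ k ≤ s ^ (2 * (k / 2)) + s ^ (2 * (k / 2 + 1)) := by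
  rw [← (even_two_mul (k / 2)).pow_abs s, ← (even_two_mul (k / 2 + 1)).pow_abs s]
  have h0 := abs_nonneg s
  rcases le_total |s| 1 with h | h
  · exact (pow_le_pow_of_le_one h0 h (by omega)).trans
      (le_add_of_nonneg_right (by positivity))
  · exact (pow_le_pow_right₀ h (by omega)).trans (le_add_of_nonneg_left (by positivity))

theorem HasMoments.integral_abs_pow_le {ν : Measure ℝ} (hν : HasMoments g ν) {C : ℝ} (hC : 1 ≤ C)
    (hg : ∀ k, |g k| ≤ C ^ k) (k : ℕ) :
    ∫ s, |s| ^ k ∂ν ≤ 2 * ((k + 3).factorial * C ^ (k + 3)) := by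
  have h1 : ∀ n ≤ k + 2, ∫ s, s ^ n ∂ν ≤ (k + 3).factorial * C ^ (k + 3) := by
    intro n hn
    rw [hν.integral_pow]
    have hf : ((n + 1).factorial : ℝ) ≤ (k + 3).factorial := by
      exact_mod_cast Nat.factorial_le (by omega)
    have hgn : g (n + 1) ≤ C ^ (k + 3) := (le_abs_self _).trans
      ((hg _).trans (pow_le_pow_right₀ hC (by omega)))
    calc ((n + 1).factorial : ℝ) * g (n + 1) ≤ (n + 1).factorial * C ^ (k + 3) := by gcongr
      _ ≤ (k + 3).factorial * C ^ (k + 3) := by gcongr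
  have hi : ∀ n : ℕ, Integrable (fun s : ℝ => s ^ n) ν := hν.integrable_pow
  calc ∫ s, |s| ^ k ∂ν ≤ ∫ s, (s ^ (2 * (k / 2)) + s ^ (2 * (k / 2 + 1))) ∂ν := by
        refine integral_mono ?_ ((hi _).add (hi _)) fun s => abs_pow_le s k
        simpa using (hi k).abs
    _ = ∫ s, s ^ (2 * (k / 2)) ∂ν + ∫ s, s ^ (2 * (k / 2 + 1)) ∂ν := integral_add (hi _) (hi _)
    _ ≤ _ := by
      rw [two_mul (_ * _)]
      exact add_le_add (h1 _ (by omega)) (h1 _ (by omega))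

/-- The derivatives at `x` of the function with derivatives `a` at `0`. -/
noncomputable def translate (a : ℕ → ℂ) (x : ℂ) (k : ℕ) : ℂ := ofSeq (fun n => a (n + k)) x

theorem IsRapid.translate {a : ℕ → ℂ} (ha : IsRapid a) (x : ℂ) : IsRapid (translate a x) := by
  intro R hR
  obtain ⟨K, hK⟩ := ha R hR
  refine ⟨K * Real.exp (‖x‖ / R), fun k => ?_⟩
  have h : ∀ n, ‖a (n + k)‖ * R ^ n ≤ K / R ^ k := fun n => by
    rw [le_div_iff₀ (by positivity), mul_assoc, ← pow_add]
    exact hK _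
  have h1 := norm_ofSeq_le hR h x
  rw [div_mul_eq_mul_div, le_div_iff₀ (by positivity)] at h1
  exact h1

theorem ofSeq_add {a : ℕ → ℂ} (ha : IsRapid a) (x z : ℂ) :
    ofSeq a (x + z) = ofSeq (translate a x) z := by
  rw [← Complex.taylorSeries_eq_of_entire (differentiable_ofSeq ha) x (x + z), ofSeq]
  refine tsum_congr fun k => ?_
  rw [iteratedDeriv_ofSeq ha, add_sub_cancel_left, smul_eq_mul, smul_eq_mul, translate]
  ring

/-- D commutes with translations (an interchange of two absolutely convergent sums), so its value at
x can be computed at 0. -/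
theorem ofSeq_lower {C : ℝ} (hC : 0 ≤ C) (hg : ∀ k, |g k| ≤ C ^ k) {a : ℕ → ℂ} (ha : IsRapid a)
    (x : ℂ) : ofSeq (lower g a) x = lower g (translate a x) 0 := by
  have hR : 0 < 2 * C + 1 := by linarith
  obtain ⟨K, hK⟩ := ha (2 * C + 1) hR
  have hsum : Summable (Function.uncurry fun n k : ℕ =>
      (g k : ℂ) * (a (n + k) / n.factorial * x ^ n)) := by
    have hs : Summable fun p : ℕ × ℕ =>
        ((‖x‖ / (2 * C + 1)) ^ p.1 / p.1.factorial) * (1 / 2 : ℝ) ^ p.2 :=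
      summable_mul_of_summable_norm
        (f := fun n : ℕ => (‖x‖ / (2 * C + 1)) ^ n / (n.factorial : ℝ))
        (g := fun k : ℕ => (1 / 2 : ℝ) ^ k)
        (Real.summable_pow_div_factorial _).norm summable_geometric_two.norm
    refine Summable.of_norm_bounded (hs.mul_left K) ?_
    rintro ⟨n, k⟩
    have h1 := norm_term_le (a := fun n => (g k : ℂ) * a (n + k)) hR
      (fun n => norm_mul_le_geometric hC hg hR (by linarith) hK n k) (z := x) le_rfl n
    refine le_trans (le_of_eq ?_) (h1.trans_eq ?_)
    · simp only [Function.uncurry]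
      ring_nf
    · simp only
      ring
  calc ofSeq (lower g a) x = ∑' n, ∑' k, (g k : ℂ) * (a (n + k) / n.factorial * x ^ n) := by
        refine tsum_congr fun n => ?_
        rw [lower, div_mul_eq_mul_div, mul_div_assoc, ← tsum_mul_right]
        refine tsum_congr fun k => ?_
        ring
    _ = ∑' k, ∑' n, (g k : ℂ) * (a (n + k) / n.factorial * x ^ n) := (hsum.tsum_comm).symm
    _ = lower g (translate a x) 0 := by
        refine tsum_congr fun k => ?_
        rw [tsum_mul_left, zero_add]
        rfl

theorem integrable_of_hasSum_of_summable_integral_norm {ν : Measure ℝ} {T : ℕ → ℝ → ℂ} {S : ℝ → ℂ}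
    (hT : ∀ k, Integrable (T k) ν) (hs : Summable fun k => ∫ s, ‖T k s‖ ∂ν)
    (hS : AEStronglyMeasurable S ν) (h : ∀ᵐ s ∂ν, HasSum (fun k => T k s) (S s)) :
    Integrable S ν ∧ ∫ s, S s ∂ν = ∑' k, ∫ s, T k s ∂ν := by
  refine ⟨⟨hS, ?_⟩, ?_⟩
  · have h1 : ∀ᵐ s ∂ν, ‖S s‖ₑ ≤ ∑' k, ‖T k s‖ₑ := by
      filter_upwards [h] with s hs
      rw [← hs.tsum_eq]
      exact enorm_tsum_le_tsum_enorm
    refine (lintegral_mono_ae h1).trans_lt ?_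
    rw [lintegral_tsum fun k => (hT k).1.enorm]
    have h2 : ∀ k, ∫⁻ s, ‖T k s‖ₑ ∂ν = ENNReal.ofReal (∫ s, ‖T k s‖ ∂ν) := fun k =>
      (ofReal_integral_norm_eq_lintegral_enorm (hT k)).symm
    simp only [h2]
    rw [← ENNReal.ofReal_tsum_of_nonneg (fun k => integral_nonneg fun _ => norm_nonneg _) hs]
    exact ENNReal.ofReal_lt_top
  · rw [integral_tsum_of_summable_integral_norm hT hs]
    refine integral_congr_ae ?_
    filter_upwards [h] with s hs
    exact hs.tsum_eq.symm

theorem HasMoments.integral_difference_quotient {ν : Measure ℝ} (hν : HasMoments g ν)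
    (hg : IsRiccatiSeries lam eta g) (h0 : ν {0} = 0) {b : ℕ → ℂ} (hb : IsRapid b) :
    Integrable (fun s : ℝ => (ofSeq b s - ofSeq b 0) / (s : ℂ)) ν ∧
      ∫ s : ℝ, (ofSeq b s - ofSeq b 0) / (s : ℂ) ∂ν = lower g b 0 := by
  set C : ℝ := 1 + |lam| + |eta| with hC
  have hC1 : 1 ≤ C := by linarith [abs_nonneg lam, abs_nonneg eta]
  have hC0 : 0 < C := by linarith
  set T : ℕ → ℝ → ℂ := fun k s => b (k + 1) / (k + 1).factorial * ((s ^ k : ℝ) : ℂ) with hTdef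
  have hT : ∀ k, Integrable (T k) ν := fun k => (hν.integrable_pow k).ofReal.const_mul _
  have hTn : ∀ k, ∫ s, ‖T k s‖ ∂ν = ‖b (k + 1)‖ / (k + 1).factorial * ∫ s, |s| ^ k ∂ν := by
    intro k
    rw [← integral_const_mul]
    refine integral_congr_ae (Filter.Eventually.of_forall fun s => ?_)
    simp [hTdef]
  have hsum : Summable fun k => ∫ s, ‖T k s‖ ∂ν := by
    -- The moment bound costs C^{k+3} and (k+3)!/(k+1)! = (k+2)(k+3) ≤ 8·4^k; the rate 8C = 2·4·C
    -- pays for both and leaves 2^{-k}.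
    obtain ⟨K, hK⟩ := hb (8 * C) (by positivity)
    refine Summable.of_nonneg_of_le (fun k => integral_nonneg fun _ => norm_nonneg _)
      (fun k => ?_) (summable_geometric_two.mul_left (2 * C ^ 2 * K))
    have hk : ((k : ℝ) + 2) * (k + 3) ≤ 8 * 4 ^ k := by
      induction k with
      | zero => norm_num
      | succ k ih =>
        push_cast
        rw [pow_succ]
        nlinarith [(Nat.cast_nonneg k : (0 : ℝ) ≤ k)]
    have h1 := hK (k + 1)
    rw [hTn]
    calc ‖b (k + 1)‖ / (k + 1).factorial * ∫ s, |s| ^ k ∂ν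
        ≤ ‖b (k + 1)‖ / (k + 1).factorial * (2 * ((k + 3).factorial * C ^ (k + 3))) := by
          gcongr
          exact hν.integral_abs_pow_le hC1 hg.abs_le k
      _ = 2 * ‖b (k + 1)‖ * C ^ (k + 3) * ((k + 2) * (k + 3)) := by
          have : ((k + 1).factorial : ℝ) ≠ 0 := by positivity
          rw [Nat.factorial_succ (k + 2), Nat.factorial_succ (k + 1)]
          push_cast
          field_simp
          ring
      _ ≤ 2 * ‖b (k + 1)‖ * C ^ (k + 3) * (8 * 4 ^ k) := by
          exact mul_le_mul_of_nonneg_left hk (by positivity)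
      _ = 2 * C ^ 2 * (‖b (k + 1)‖ * (8 * C) ^ (k + 1)) * (1 / 2) ^ k := by
          have : (8 : ℝ) ^ k = 4 ^ k * 2 ^ k := by rw [← mul_pow]; norm_num
          rw [mul_pow, pow_succ 8 k, this, one_div, inv_pow]
          field_simp
          ring
      _ ≤ 2 * C ^ 2 * K * (1 / 2) ^ k := by gcongr
  have hmeas : AEStronglyMeasurable (fun s : ℝ => (ofSeq b s - ofSeq b 0) / (s : ℂ)) ν := by
    have h1 : Continuous (ofSeq b) := (differentiable_ofSeq hb).continuous
    have h2 : Measurable fun s : ℝ => ofSeq b s := (h1.comp Complex.continuous_ofReal).measurable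
    exact ((h2.sub_const _).div Complex.measurable_ofReal).aestronglyMeasurable
  have hae : ∀ᵐ s ∂ν, HasSum (fun k => T k s) ((ofSeq b s - ofSeq b 0) / (s : ℂ)) := by
    have hne : ∀ᵐ s : ℝ ∂ν, s ≠ 0 := by
      rw [ae_iff]
      simpa using h0
    filter_upwards [hne] with s hs
    have hs' : (s : ℂ) ≠ 0 := Complex.ofReal_ne_zero.2 hs
    have h1 := ((hasSum_nat_add_iff' 1).2 (hasSum_ofSeq hb s)).div_const (s : ℂ)
    simp only [Finset.range_one, Finset.sum_singleton, Nat.factorial_zero, Nat.cast_one, div_one,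
      pow_zero, mul_one] at h1
    rw [ofSeq_zero]
    refine h1.congr_fun fun k => ?_
    simp only [hTdef]
    push_cast
    field_simp
    ring
  obtain ⟨h1, h2⟩ := integrable_of_hasSum_of_summable_integral_norm hT hsum hmeas hae
  refine ⟨h1, ?_⟩
  rw [h2, lower, (summable_lower hC0.le hg.abs_le hb 0).tsum_eq_zero_add, hg.zero]
  simp only [Complex.ofReal_zero, zero_mul, zero_add]
  refine tsum_congr fun k => ?_
  simp only [hTdef]
  rw [integral_const_mul, integral_complex_ofReal, hν.integral_pow]
  have : ((k + 1).factorial : ℂ) ≠ 0 := Nat.cast_ne_zero.2 (k + 1).factorial_ne_zero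
  push_cast
  field_simp

theorem lowerOp_apply (hg : IsRiccatiSeries lam eta g) (f : EMin) (x : ℝ) :
    (lowerOp hg f : ℝ → ℂ) x = lower g (translate (seq f) x) 0 :=
  ofSeq_lower (by positivity) hg.abs_le (isRapid_seq f) x

/-- Here g' = 1, so g(u) = u and D is plain differentiation. -/
theorem IsRiccatiSeries.lower_of_eq_zero (hg : IsRiccatiSeries 0 0 g) (a : ℕ → ℂ) :
    lower g a 0 = a 1 := by
  have h1 : g 1 = 1 := by simpa using hg.succ 0
  rw [lower, tsum_eq_single 1]
  · simp [h1]
  · intro k hk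
    cases k with
    | zero => simp [hg.zero]
    | succ k =>
      have h2 := hg.succ k
      rw [if_neg (by omega), zero_mul, zero_mul, add_zero, add_zero] at h2
      have h3 : g (k + 1) = 0 := (mul_eq_zero.1 h2).resolve_left (by positivity)
      simp [h3]

end Meixner

theorem theorem1 (lam eta : ℝ) (heta : 0 ≤ eta) :
    (∃ ν : Measure ℝ, Meixner.IsOrthogonalityMeasure (Meixner.Q lam eta) ν) ∧
    (∃! D : Meixner.EMin →ₗ[ℂ] Meixner.EMin, Meixner.IsLoweringOperator lam eta D) ∧
    ∀ (ν : Measure ℝ) (D : Meixner.EMin →ₗ[ℂ] Meixner.EMin),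
      Meixner.IsOrthogonalityMeasure (Meixner.Q lam eta) ν →
      Meixner.IsLoweringOperator lam eta D →
      ∀ (f : Meixner.EMin) (x : ℝ),
        (¬ (lam = 0 ∧ eta = 0) →
          Integrable (fun s : ℝ => ((f : ℝ → ℂ) (x + s) - (f : ℝ → ℂ) x) / (s : ℂ)) ν ∧
          (D f : ℝ → ℂ) x
            = ∫ s : ℝ, ((f : ℝ → ℂ) (x + s) - (f : ℝ → ℂ) x) / (s : ℂ) ∂ν) ∧
        (lam = 0 ∧ eta = 0 →
          HasDerivAt (f : ℝ → ℂ) ((D f : ℝ → ℂ) x) x) := by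
  obtain ⟨ν₀, g, hg, hν₀⟩ := Meixner.exists_hasMoments lam heta
  refine ⟨⟨ν₀, hν₀.isOrthogonalityMeasure hg⟩,
    ⟨Meixner.lowerOp hg, Meixner.isLoweringOperator_lowerOp hg,
      fun D hD => hD.unique (Meixner.isLoweringOperator_lowerOp hg)⟩, ?_⟩
  intro ν D hν hD f x
  have hrapid := Meixner.isRapid_seq f
  rw [hD.unique (Meixner.isLoweringOperator_lowerOp hg), Meixner.lowerOp_apply]
  constructor
  · intro hne
    -- The given ν may differ from ν₀, but it shares its moments, which is all that the integration
    -- uses apart from ν{0} = 0.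
    have h := (hν.hasMoments hν₀ hg).integral_difference_quotient hg (hν.measure_zero heta hne)
      (hrapid.translate x)
    have e : ∀ s : ℝ, (f : ℝ → ℂ) (x + s)
        = Meixner.ofSeq (Meixner.translate (Meixner.seq f) x) s := fun s => by
      rw [← Meixner.ofSeq_add hrapid, ← Complex.ofReal_add]
      exact congrFun (Meixner.eq_ofSeq_seq f) (x + s)
    have e0 : (f : ℝ → ℂ) x = Meixner.ofSeq (Meixner.translate (Meixner.seq f) x) 0 := by
      simpa using e 0
    simp only [e, e0]
    exact ⟨h.1, h.2.symm⟩
  · rintro ⟨rfl, rfl⟩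
    rw [hg.lower_of_eq_zero, Meixner.eq_ofSeq_seq f]
    exact (Meixner.hasDerivAt_ofSeq hrapid x).comp_ofReal
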